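/- Notation. For $N\in\mathbb{N}$ let $\mathcal{S}:\mathbb{C}^{N\times N}\to\mathbb{C}^{N\times N}$ be a linear operator that preserves positivity, i.e. $\mathcal{S}(R)\ge 0$ whenever $R\ge 0$ (for example the self-energy operator $\mathcal{S}(R)=\mathbb{E}[HRH]$ of a Hermitian random matrix $H$). Its coefficients $\mathcal{S}_{xy,zt}$ are defined by $\mathcal{S}(R)_{xt}=\sum_{y,z=1}^N \mathcal{S}_{xy,zt}R_{yz}$. For $l>0$ put $$\|\mathcal{S}\|_l=\max_{x,y,z,t}e^{\rho(xy,zt)/l}|\mathcal{S}_{xy,zt}|,\quad \rho(xy,zt)=\min\{|x-t|+|y-z|,\,|x-z|+|y-t|\},\qquad \|A\|_l=\max_{a,b}e^{|a-b|/l}|A_{ab}|$$ for $A\in\mathbb{C}^{N\times N}$. The Matrix Dyson Equation (MDE) at $z\in\mathbb{C}$ is $-M^{-1}=z+\mathcal{S}(M)$ for an invertible $M\in\mathbb{C}^{N\times N}$. Let $\mathcal{T}_k$ be the set of ordered (plane) rooted trees with $k$ edges. For $\Gamma\in\mathcal{T}_k$ let $c(v)$ be the number of children of the vertex $v$; for an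 edge $e$ let $e_-$ be its end closer to the root and $e_+$ the other end, and let $e_+$ be the $n(e_+)$-th child of $e_-$. A labelling $\mathbf{x}\in\mathcal{X}_{ab}(\Gamma)$ assigns to every vertex $v$ labels $x^v_0,\dots,x^v_{c(v)}\in\{1,\dots,N\}$ such that $x^{root}_0=a$ and $x^{root}_{c(root)}=b$. Define the matrices $\mathrm{val}(\Gamma)$ and $C_k$ and the Laurent series $M(z)$ by $$\mathrm{val}_{ab}(\Gamma)=\sum_{\mathbf{x}\in\mathcal{X}_{ab}(\Gamma)}\ \prod_{e\in E(\Gamma)}\mathcal{S}_{x^{e_-}_{n(e_+)-1}x^{e_+}_0,\;x^{e_+}_{c(e_+)}x^{e_-}_{n(e_+)}},\qquad C_k=\sum_{\Gamma\in\mathcal{T}_k}\mathrm{val}(\Gamma),\qquad M(z)=-\sum_{k=0}^\infty C_kz^{-2k-1}.$$ Theorem. For all $l>0$ and $\varepsilon>0$ there is a constant $K=K(l,\varepsilon)>0$ such that the following holds for all $c\ge 0$, all $N$ and all positivity preserving linear $\mathcal{S}$ on $\mathbb{C}^{N\times N}$ with $\|\mathcal{S}\|_l\le c/N$. Put $R=R(l,\varepsilon)=Kc$.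 1. $\|C_k\|_{(1+\varepsilon)l}\le R^k$ for every $k\ge 0$. 2. For every $z\in\mathbb{C}$ with $|z|^2>R$ the series $M(z)$ converges absolutely in the $(1+\varepsilon)l$-norm, its sum satisfies the MDE at $z$, and, uniformly in $N$, $$\|M(z)\|_{(1+\varepsilon)l}\le |z|^{-1}\bigl(1-R|z|^{-2}\bigr)^{-1},$$ so that $M(z)$ has exponential off-diagonal decay. 3. For every $z\in\mathbb{H}=\{\operatorname{Im}z>0\}$ the MDE has exactly one solution $\widetilde M(z)$ whose imaginary part $\frac{1}{2i}(\widetilde M(z)-\widetilde M(z)^*)$ is positive definite, and $\widetilde M(z)=M(z)$ for all $z\in\mathbb{H}$ with $|z|^2>R$. -/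

import Mathlib

namespace MDE

/-- Finite rooted trees in which the children of every vertex are linearly ordered:
`node n child` has a root with `n` children, the `i`-th one being the root of `child i`. -/
inductive OrderedTree : Type
  | node (n : ℕ) (child : Fin n → OrderedTree) : OrderedTree

namespace OrderedTree

/-- The vertices of an ordered tree: the root, and the vertices of the subtrees. -/
def Vertex : OrderedTree → Type
  | node n child => Option ((i : Fin n) × Vertex (child i))

/-- The root. -/
def root : (Γ : OrderedTree) → Vertex Γ
  | node _ _ => none

/-- The number `c(v)` of children of a vertex `v`. -/
def numChildren : (Γ : OrderedTree) → Vertex Γ → ℕ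
  | node n _, none => n
  | node _ child, some ⟨i, v⟩ => numChildren (child i) v

/-- The `j`-th child of a vertex (counted from `0`). -/
def childOf : (Γ : OrderedTree) → (v : Vertex Γ) → Fin (numChildren Γ v) → Vertex Γ
  | node _ child, none, i => some ⟨i, root (child i)⟩
  | node _ child, some ⟨i, v⟩, j => some ⟨i, childOf (child i) v j⟩

/-- An edge `e` is given by its upper end `e₋` and the position of its lower end `e₊` among the
children of `e₋`. -/
abbrev Edge (Γ : OrderedTree) : Type := (v : Vertex Γ) × Fin (numChildren Γ v)

/-- The vertices `p_0^v, …, p_{c(v)}^v` of the frame of `Γ`: a walk around the tree visits each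
vertex `v` exactly `c(v) + 1` times. -/
abbrev FramePoint (Γ : OrderedTree) : Type := (v : Vertex Γ) × Fin (numChildren Γ v + 1)

/-- A labelling `x` of the frame by elements of `[N]`; the label `x_j^v` is `x ⟨v, j⟩`. -/
abbrev Labelling (Γ : OrderedTree) (N : ℕ) : Type := FramePoint Γ → Fin N

instance instFintypeVertex : (Γ : OrderedTree) → Fintype (Vertex Γ)
  | node n child =>
    haveI : ∀ i, Fintype (Vertex (child i)) := fun i => instFintypeVertex (child i)
    inferInstanceAs (Fintype (Option ((i : Fin n) × Vertex (child i))))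

noncomputable instance instDecidableEqVertex (Γ : OrderedTree) : DecidableEq (Vertex Γ) :=
  Classical.decEq _

/-- The number of edges. -/
def numEdges (Γ : OrderedTree) : ℕ := Fintype.card (Edge Γ)

theorem numEdges_node (n : ℕ) (child : Fin n → OrderedTree) :
    numEdges (node n child) = n + ∑ i, numEdges (child i) := by
  let e : Edge (node n child) ≃ Fin n ⊕ ((i : Fin n) × Edge (child i)) :=
    { toFun := fun x => match x with
        | ⟨none, i⟩ => Sum.inl i
        | ⟨some ⟨i, v⟩, j⟩ => Sum.inr ⟨i, ⟨v, j⟩⟩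
      invFun := fun x => match x with
        | Sum.inl i => ⟨none, i⟩
        | Sum.inr ⟨i, ⟨v, j⟩⟩ => ⟨some ⟨i, v⟩, j⟩
      left_inv := by rintro ⟨_ | ⟨i, v⟩, j⟩ <;> rfl
      right_inv := by rintro (i | ⟨i, ⟨v, j⟩⟩) <;> rfl }
  unfold numEdges
  rw [Fintype.card_congr e, Fintype.card_sum, Fintype.card_sigma, Fintype.card_fin]

theorem finite_numEdges_eq (k : ℕ) : {Γ : OrderedTree | numEdges Γ = k}.Finite := by
  induction k using Nat.strong_induction_on with
  | _ k ih =>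
    have hlt : {Γ : OrderedTree | numEdges Γ < k}.Finite := by
      have : {Γ : OrderedTree | numEdges Γ < k}
          = ⋃ j ∈ Set.Iio k, {Γ : OrderedTree | numEdges Γ = j} := by
        ext Γ; simp
      rw [this]
      exact (Set.finite_Iio k).biUnion fun j hj => ih j hj
    refine ((Set.finite_Iic k).biUnion fun n _ =>
      (Set.Finite.pi' fun _ : Fin n => hlt).image (node n)).subset ?_
    rintro ⟨n, child⟩ h
    have h : n + ∑ i, numEdges (child i) = k := by rw [← numEdges_node]; exact h
    refine Set.mem_biUnion (x := n) (by simp only [Set.mem_Iic]; omega) ⟨child, fun i => ?_, rfl⟩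
    have h1 : numEdges (child i) ≤ ∑ i, numEdges (child i) :=
      Finset.single_le_sum (f := fun i => numEdges (child i)) (fun _ _ => Nat.zero_le _)
        (Finset.mem_univ i)
    have h2 := i.pos
    change numEdges (child i) < k
    omega

/-- The set `𝒯_k` of ordered trees with `k` edges. -/
noncomputable def treesWithEdges (k : ℕ) : Finset OrderedTree := (finite_numEdges_eq k).toFinset

end OrderedTree

open OrderedTree

/-- The coefficients `S_{xy,zt}` of a linear map `S` on `N × N` matrices, which are determined by
`S(R)_{xt} = ∑_{y,z} S_{xy,zt} R_{yz}`. -/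
noncomputable def coeff {N : ℕ}
    (S : Matrix (Fin N) (Fin N) ℂ →ₗ[ℂ] Matrix (Fin N) (Fin N) ℂ) (x y z t : Fin N) : ℂ :=
  S (Matrix.single y z 1) x t

/-- `|x - y|` for indices `x, y ∈ [N]`. -/
noncomputable def idxDist {N : ℕ} (x y : Fin N) : ℝ := |((x : ℕ) : ℝ) - ((y : ℕ) : ℝ)|

/-- `ρ(xy, zt) = min{|x - t| + |y - z|, |x - z| + |y - t|}`. -/
noncomputable def rho {N : ℕ} (x y z t : Fin N) : ℝ :=
  min (idxDist x t + idxDist y z) (idxDist x z + idxDist y t)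

/-- The `l`-norm of a matrix, `max_{a,b} e^{|a-b|/l} |A_{ab}|`. -/
noncomputable def matLNorm {N : ℕ} (l : ℝ) (A : Matrix (Fin N) (Fin N) ℂ) : ℝ :=
  ⨆ p : Fin N × Fin N, Real.exp (idxDist p.1 p.2 / l) * ‖A p.1 p.2‖

/-- The `l`-norm of an operator on matrices, `max_{x,y,z,t} e^{ρ(xy,zt)/l} |S_{xy,zt}|`. -/
noncomputable def opLNorm {N : ℕ} (l : ℝ)
    (S : Matrix (Fin N) (Fin N) ℂ →ₗ[ℂ] Matrix (Fin N) (Fin N) ℂ) : ℝ :=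
  ⨆ p : Fin N × Fin N × Fin N × Fin N,
    Real.exp (rho p.1 p.2.1 p.2.2.1 p.2.2.2 / l) * ‖coeff S p.1 p.2.1 p.2.2.1 p.2.2.2‖

/-- The value `val(Γ)` of an ordered tree: the `(a, b)` entry sums, over the labellings with
`x_0^{root} = a` and `x_{c(root)}^{root} = b`, the product over the edges `e` of
`S_{x_{n(e₊)-1}^{e₋} x_0^{e₊}, x_{c(e₊)}^{e₊} x_{n(e₊)}^{e₋}}`, where `e₊` is the `n(e₊)`-th child
of `e₋`, counted from `1`. -/
noncomputable def val {N : ℕ}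
    (S : Matrix (Fin N) (Fin N) ℂ →ₗ[ℂ] Matrix (Fin N) (Fin N) ℂ) (Γ : OrderedTree) :
    Matrix (Fin N) (Fin N) ℂ :=
  Matrix.of fun a b =>
    ∑ x : Labelling Γ N with x ⟨root Γ, 0⟩ = a ∧ x ⟨root Γ, Fin.last _⟩ = b,
      ∏ e : Edge Γ,
        coeff S (x ⟨e.1, e.2.castSucc⟩) (x ⟨childOf Γ e.1 e.2, 0⟩)
          (x ⟨childOf Γ e.1 e.2, Fin.last _⟩) (x ⟨e.1, e.2.succ⟩)

/-- `C_k = ∑_{Γ ∈ 𝒯_k} val(Γ)`. -/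
noncomputable def treeCoeff {N : ℕ}
    (S : Matrix (Fin N) (Fin N) ℂ →ₗ[ℂ] Matrix (Fin N) (Fin N) ℂ) (k : ℕ) :
    Matrix (Fin N) (Fin N) ℂ :=
  ∑ Γ ∈ treesWithEdges k, val S Γ

/-- The `k`-th term `-C_k z^{-2k-1}` of the Laurent series over ordered trees. -/
noncomputable def seriesTerm {N : ℕ}
    (S : Matrix (Fin N) (Fin N) ℂ →ₗ[ℂ] Matrix (Fin N) (Fin N) ℂ) (z : ℂ) (k : ℕ) :
    Matrix (Fin N) (Fin N) ℂ :=
  -((z ^ (2 * k + 1))⁻¹ • treeCoeff S k)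

/-- The sum `M(z) = -∑_k C_k z^{-2k-1}` of the Laurent series. -/
noncomputable def treeSeries {N : ℕ}
    (S : Matrix (Fin N) (Fin N) ℂ →ₗ[ℂ] Matrix (Fin N) (Fin N) ℂ) (z : ℂ) :
    Matrix (Fin N) (Fin N) ℂ :=
  ∑' k, seriesTerm S z k

/-- `M` solves the Matrix Dyson Equation `-M⁻¹ = z + S(M)` at `z`. -/
def SolvesMDE {N : ℕ}
    (S : Matrix (Fin N) (Fin N) ℂ →ₗ[ℂ] Matrix (Fin N) (Fin N) ℂ) (z : ℂ)
    (M : Matrix (Fin N) (Fin N) ℂ) : Prop :=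
  IsUnit M ∧ -M⁻¹ = z • (1 : Matrix (Fin N) (Fin N) ℂ) + S M

open scoped ComplexOrder in
/-- `Im M = (M - M*) / (2i)` is positive definite. -/
def HasPosIm {N : ℕ} (M : Matrix (Fin N) (Fin N) ℂ) : Prop :=
  ((2 * Complex.I)⁻¹ • (M - M.conjTranspose)).PosDef

open scoped ComplexOrder in
/-- `S` maps positive semidefinite matrices to positive semidefinite matrices, as the self-energy
operator `R ↦ E[H R H]` of every Hermitian random matrix `H` does. -/
def PositivityPreserving {N : ℕ}
    (S : Matrix (Fin N) (Fin N) ℂ →ₗ[ℂ] Matrix (Fin N) (Fin N) ℂ) : Prop :=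
  ∀ R : Matrix (Fin N) (Fin N) ℂ, R.PosSemidef → (S R).PosSemidef

end MDE

/-! Splitting a tree at the first child of its root gives the Catalan-type recursion `C_{k+1} =
∑_{i+j=k} S(C_i) C_j` with `C_0 = 1` (`treeCoeff_succ`). It yields both the size of the coefficients
and the equation: as a Cauchy product, it says `(z + S(M)) M = -1` for the series `M`.

For the size, an entrywise norm is not submultiplicative uniformly in `N`, so the induction runs
with exponentially weighted row and column sums. With `l' = (1 + ε) l`, `S` maps entrywise bounds to
bounds on weighted row sums, with a constant `κ` proportional to `c` and independent of `N`
(`EntryBound.rowBound_apply`). Hence `C_k` is bounded by `catalan k * κ ^ k ≤ (4κ) ^ k`, and the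
series is dominated by a geometric one when `|z|² > 4κ`.

For `Im z > 0`, the map `M ↦ -(z + S(M))⁻¹` sends a bounded piece of the matrix upper half plane
strictly inside itself, so the Earle–Hamilton theorem gives exactly one fixed point there; a priori
bounds put every solution with positive imaginary part in that piece.

To identify this solution with the series, `Im M = Im z · M*M + M* S(Im M) M` is iterated. For large
`|z|` the linear part contracts, so `Im M ≥ Im z · M*M > 0`, and uniqueness applies. -/

namespace MDE

open OrderedTree

/-! ### Ordered trees: values as matrix products, and the recursion for `C_k` -/

section Trees

variable {N : ℕ}

/-- A product of matrices as a sum over paths of indices. -/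
theorem sum_paths_eq_prod {n : ℕ} (A : Fin n → Matrix (Fin N) (Fin N) ℂ) (a b : Fin N) :
    ∑ r : Fin (n + 1) → Fin N with r 0 = a ∧ r (Fin.last n) = b,
      ∏ i, A i (r i.castSucc) (r i.succ) = (List.ofFn A).prod a b := by
  induction n generalizing a with
  | zero =>
    simp only [Finset.univ_eq_empty, Finset.prod_empty, List.ofFn_zero, List.prod_nil,
      Matrix.one_apply, Finset.sum_filter]
    rw [← (Equiv.funUnique (Fin 1) (Fin N)).symm.sum_comp]
    simp only [Equiv.funUnique_symm_apply, uniqueElim_const, Fin.last_zero, Fin.isValue]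
    by_cases h : a = b
    · subst h; simp
    · rw [if_neg h]
      refine Finset.sum_eq_zero fun x _ => if_neg ?_
      rintro ⟨rfl, h'⟩; exact h h'
  | succ n ih =>
    rw [List.ofFn_succ, List.prod_cons, Matrix.mul_apply]
    simp_rw [← ih, Finset.sum_filter, Finset.mul_sum]
    rw [← (Fin.consEquiv fun _ : Fin (n + 2) => Fin N).sum_comp, Fintype.sum_prod_type]
    simp only [Fin.consEquiv_apply, Fin.cons_zero, ← Fin.succ_last, Fin.cons_succ,
      Fin.prod_univ_succ, Fin.castSucc_zero, ← Fin.succ_castSucc]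
    rw [Finset.sum_eq_single a]
    · rw [Finset.sum_comm]
      refine Finset.sum_congr rfl fun r _ => ?_
      rw [Finset.sum_eq_single (r 0)]
      · simp
      · intro y _ hy; simp [hy.symm]
      · simp
    · intro x _ hx; simp [hx]
    · simp

/-- A labelling of a tree consists of the labels at its root and labellings of the subtrees. -/
def labellingEquiv (n : ℕ) (child : Fin n → OrderedTree) :
    Labelling (node n child) N ≃ (Fin (n + 1) → Fin N) × ((i : Fin n) → Labelling (child i) N) where
  toFun x := (fun j => x ⟨none, j⟩, fun i p => x ⟨some ⟨i, p.1⟩, p.2⟩)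
  invFun y := fun p => match p with
    | ⟨none, j⟩ => y.1 j
    | ⟨some ⟨i, v⟩, j⟩ => y.2 i ⟨v, j⟩
  left_inv x := by
    funext p
    rcases p with ⟨_ | ⟨i, v⟩, j⟩ <;> rfl
  right_inv y := rfl

/-- An edge of a tree is an edge at the root or an edge of a subtree. -/
def edgeEquiv (n : ℕ) (child : Fin n → OrderedTree) :
    Edge (node n child) ≃ Fin n ⊕ ((i : Fin n) × Edge (child i)) where
  toFun x := match x with
    | ⟨none, i⟩ => Sum.inl i
    | ⟨some ⟨i, v⟩, j⟩ => Sum.inr ⟨i, ⟨v, j⟩⟩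
  invFun x := match x with
    | Sum.inl i => ⟨none, i⟩
    | Sum.inr ⟨i, ⟨v, j⟩⟩ => ⟨some ⟨i, v⟩, j⟩
  left_inv := by rintro ⟨_ | ⟨i, v⟩, j⟩ <;> rfl
  right_inv := by rintro (i | ⟨i, ⟨v, j⟩⟩) <;> rfl

variable (S : Matrix (Fin N) (Fin N) ℂ →ₗ[ℂ] Matrix (Fin N) (Fin N) ℂ)

theorem apply_eq_sum_coeff (R : Matrix (Fin N) (Fin N) ℂ) (x t : Fin N) :
    S R x t = ∑ y, ∑ z, coeff S x y z t * R y z := by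
  conv_lhs => rw [Matrix.matrix_eq_sum_single R]
  simp only [map_sum, Matrix.sum_apply, coeff]
  refine Finset.sum_congr rfl fun y _ => Finset.sum_congr rfl fun z _ => ?_
  have : Matrix.single y z (R y z) = R y z • Matrix.single y z (1 : ℂ) := by
    rw [Matrix.smul_single, smul_eq_mul, mul_one]
  rw [this, map_smul, Matrix.smul_apply, smul_eq_mul, mul_comm]

/-- The weight of a single labelling. -/
noncomputable def labelWeight (Γ : OrderedTree) (x : Labelling Γ N) : ℂ :=
  ∏ e : Edge Γ,
    coeff S (x ⟨e.1, e.2.castSucc⟩) (x ⟨childOf Γ e.1 e.2, 0⟩)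
      (x ⟨childOf Γ e.1 e.2, Fin.last _⟩) (x ⟨e.1, e.2.succ⟩)

theorem labelWeight_node (n : ℕ) (child : Fin n → OrderedTree)
    (r : Fin (n + 1) → Fin N) (y : (i : Fin n) → Labelling (child i) N) :
    labelWeight S (node n child) ((labellingEquiv n child).symm (r, y)) =
      ∏ i, (coeff S (r i.castSucc) (y i ⟨root (child i), 0⟩)
        (y i ⟨root (child i), Fin.last _⟩) (r i.succ) * labelWeight S (child i) (y i)) := by
  rw [Finset.prod_mul_distrib]
  unfold labelWeight
  rw [← (edgeEquiv n child).symm.prod_comp, Fintype.prod_sum_type, Fintype.prod_sigma]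
  rfl

theorem apply_val (Γ : OrderedTree) (p q : Fin N) :
    S (val S Γ) p q = ∑ x : Labelling Γ N,
      coeff S p (x ⟨root Γ, 0⟩) (x ⟨root Γ, Fin.last _⟩) q * labelWeight S Γ x := by
  rw [apply_eq_sum_coeff]
  simp only [val, Matrix.of_apply, Finset.sum_filter, Finset.mul_sum]
  rw [← Fintype.sum_prod_type', Finset.sum_comm]
  refine Finset.sum_congr rfl fun x _ => ?_
  rw [Finset.sum_eq_single (x ⟨root Γ, 0⟩, x ⟨root Γ, Fin.last _⟩)]
  · simp [labelWeight]
  · rintro ⟨y, z⟩ _ h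
    rw [if_neg, mul_zero]
    rintro ⟨rfl, rfl⟩; exact h rfl
  · simp

/-- The labels at the root form a path from `a` to `b`, and given this path the labellings of the
subtrees are independent. Summing out the `i`-th subtree leaves an entry of `S (val S (child i))`;
summing over paths is matrix multiplication. -/
theorem val_node (n : ℕ) (child : Fin n → OrderedTree) :
    val S (node n child) = (List.ofFn fun i => S (val S (child i))).prod := by
  ext a b
  rw [← sum_paths_eq_prod]
  -- The product over children of sums over labellings becomes one sum over families of labellings.
  simp only [apply_val, Finset.prod_univ_sum, Fintype.piFinset_univ]
  change ∑ x : Labelling (node n child) N with x ⟨none, (0 : Fin (n + 1))⟩ = a ∧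
    x ⟨none, Fin.last n⟩ = b, labelWeight S (node n child) x = _
  rw [Finset.sum_filter, ← (labellingEquiv n child).symm.sum_comp, Fintype.sum_prod_type,
    Finset.sum_filter]
  refine Finset.sum_congr rfl fun r _ => ?_
  simp only [labelWeight_node]
  change (∑ y : (i : Fin n) → Labelling (child i) N, if r 0 = a ∧ r (Fin.last n) = b then _ else _)
    = _
  split_ifs
  · rfl
  · simp

/-- Attach a new first subtree to the root. -/
def graft (Γ₁ : OrderedTree) : OrderedTree → OrderedTree
  | node n child => node (n + 1) (Fin.cons Γ₁ child : Fin (n + 1) → OrderedTree)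

theorem val_graft (Γ₁ Γ₂ : OrderedTree) :
    val S (graft Γ₁ Γ₂) = S (val S Γ₁) * val S Γ₂ := by
  cases Γ₂ with
  | node n child => simp [graft, val_node, List.ofFn_succ]

theorem numEdges_graft (Γ₁ Γ₂ : OrderedTree) :
    numEdges (graft Γ₁ Γ₂) = numEdges Γ₁ + numEdges Γ₂ + 1 := by
  cases Γ₂ with
  | node n child =>
    simp only [graft, numEdges_node, Fin.sum_univ_succ, Fin.cons_zero, Fin.cons_succ]
    omega

theorem graft_injective {Γ₁ Γ₂ Γ₁' Γ₂' : OrderedTree} (h : graft Γ₁ Γ₂ = graft Γ₁' Γ₂') :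
    Γ₁ = Γ₁' ∧ Γ₂ = Γ₂' := by
  cases Γ₂ with
  | node n child =>
  cases Γ₂' with
  | node n' child' =>
    simp only [graft, node.injEq] at h
    obtain ⟨h1, h2⟩ := h
    obtain rfl : n = n' := by omega
    have h2 := eq_of_heq h2
    have := Fin.cons_injective2 h2
    exact ⟨this.1, by rw [this.2]⟩

theorem mem_treesWithEdges {k : ℕ} {Γ : OrderedTree} :
    Γ ∈ treesWithEdges k ↔ numEdges Γ = k := by
  simp [treesWithEdges]

theorem treeCoeff_zero : treeCoeff S 0 = 1 := by
  have h : treesWithEdges 0 = {node 0 Fin.elim0} := by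
    ext Γ
    rw [mem_treesWithEdges, Finset.mem_singleton]
    cases Γ with
    | node n child =>
      rw [numEdges_node]
      constructor
      · intro h
        obtain rfl : n = 0 := by omega
        congr 1
        funext i; exact i.elim0
      · intro h
        obtain ⟨rfl, -⟩ := node.inj h
        simp
  rw [treeCoeff, h, Finset.sum_singleton, val_node]
  simp

/-- Every tree with at least one edge is, in exactly one way, the graft of its first subtree onto
the rest. The edge joining them accounts for the shift from `k` to `k + 1`. -/
theorem treeCoeff_succ (k : ℕ) :
    treeCoeff S (k + 1) =
      ∑ p ∈ Finset.HasAntidiagonal.antidiagonal k, S (treeCoeff S p.1) * treeCoeff S p.2 := by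
  simp only [treeCoeff, map_sum, Finset.sum_mul_sum, ← val_graft, ← Finset.sum_product']
  rw [Finset.sum_sigma']
  symm
  refine Finset.sum_bij (fun x _ => graft x.2.1 x.2.2) ?_ ?_ ?_ (fun _ _ => rfl)
  · rintro ⟨⟨i, j⟩, Γ₁, Γ₂⟩ h
    simp only [Finset.mem_sigma, Finset.HasAntidiagonal.mem_antidiagonal, Finset.mem_product,
      mem_treesWithEdges] at h ⊢
    rw [numEdges_graft]; omega
  · rintro ⟨⟨i, j⟩, Γ₁, Γ₂⟩ h ⟨⟨i', j'⟩, Γ₁', Γ₂'⟩ h' he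
    simp only [Finset.mem_sigma, Finset.HasAntidiagonal.mem_antidiagonal, Finset.mem_product,
      mem_treesWithEdges] at h h'
    obtain ⟨rfl, rfl⟩ := graft_injective he
    obtain ⟨-, rfl, rfl⟩ := h
    obtain ⟨-, rfl, rfl⟩ := h'
    rfl
  · rintro ⟨n, child⟩ h
    rw [mem_treesWithEdges] at h
    cases n with
    | zero => simp [numEdges_node] at h
    | succ n =>
      have he : graft (child 0) (node n (Fin.tail child)) = node (n + 1) child := by
        simp [graft, Fin.cons_self_tail]
      rw [← he, numEdges_graft] at h
      refine ⟨⟨(numEdges (child 0), numEdges (node n (Fin.tail child))),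
        child 0, node n (Fin.tail child)⟩, ?_, he⟩
      simp only [Finset.mem_sigma, Finset.HasAntidiagonal.mem_antidiagonal, Finset.mem_product,
        mem_treesWithEdges]
      exact ⟨by omega, trivial, trivial⟩

end Trees

end MDE

namespace MDE

/-! ### Earle–Hamilton fixed point theorem via the Carathéodory metric -/

section EarleHamilton

/-- On the points of depth `δ` in `D` the Carathéodory length is controlled by the norm. Convexity
of this set permits the mean value inequality there. -/
theorem convex_setOf_ball_subset {E : Type*} [NormedAddCommGroup E] [NormedSpace ℝ E]
    {D : Set E} (hD : Convex ℝ D) (δ : ℝ) :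
    Convex ℝ {x | Metric.ball x δ ⊆ D} := by
  intro x hx y hy a b ha hb hab w hw
  rw [mem_ball_iff_norm] at hw
  have hx' : x + (w - (a • x + b • y)) ∈ D := hx (by simpa [mem_ball_iff_norm] using hw)
  have hy' : y + (w - (a • x + b • y)) ∈ D := hy (by simpa [mem_ball_iff_norm] using hw)
  convert hD hx' hy' ha hb hab using 1
  rw [smul_add, smul_add, add_add_add_comm, ← add_smul, hab, one_smul]
  abel

theorem isClosed_setOf_ball_subset {E : Type*} [NormedAddCommGroup E] (D : Set E) (δ : ℝ) :
    IsClosed {x | Metric.ball x δ ⊆ D} := by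
  rw [← isSeqClosed_iff_isClosed]
  intro u x hu hux w hw
  rw [Metric.mem_ball, dist_comm] at hw
  have := (hux.dist (tendsto_const_nhds (x := w))).eventually (gt_mem_nhds hw)
  obtain ⟨n, hn⟩ := this.exists
  exact hu n (by rwa [Metric.mem_ball, dist_comm])

variable {E : Type*} [NormedAddCommGroup E] [NormedSpace ℂ E]

/-- `lam` bounds the infinitesimal Carathéodory length of the vector `v` at `x`: every holomorphic
map from `D` to the closed unit ball has derivative of norm at most `λ` at `x` in direction `v`. -/
def CaratheodoryLE (D : Set E) (x v : E) (lam : ℝ) : Prop :=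
  ∀ f : E → E, DifferentiableOn ℂ f D → (∀ y ∈ D, ‖f y‖ ≤ 1) → ‖fderiv ℂ f x v‖ ≤ lam

/-- Cauchy's estimate for `w ↦ f (x + w • v)` on the disc of radius `δ / (2‖v‖)`, whose closure
still maps into the ball. -/
theorem caratheodoryLE_of_ball_subset [CompleteSpace E] {D : Set E} (hD : IsOpen D) {x v : E}
    {δ : ℝ} (hδ : 0 < δ) (hx : Metric.ball x δ ⊆ D) :
    CaratheodoryLE D x v (2 * ‖v‖ / δ) := by
  intro f hf hb
  rcases eq_or_ne v 0 with rfl | hv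
  · simp
  have hv' : 0 < ‖v‖ := norm_pos_iff.2 hv
  have hR : 0 < δ / (2 * ‖v‖) := by positivity
  have hmem : ∀ w ∈ Metric.closedBall (0 : ℂ) (δ / (2 * ‖v‖)), x + w • v ∈ D := by
    intro w hw
    apply hx
    rw [mem_closedBall_zero_iff] at hw
    rw [mem_ball_iff_norm, add_sub_cancel_left, norm_smul]
    calc ‖w‖ * ‖v‖ ≤ δ / (2 * ‖v‖) * ‖v‖ := by gcongr
      _ = δ / 2 := by field_simp
      _ < δ := by linarith
  have hline : ∀ w : ℂ, HasDerivAt (fun w : ℂ => x + w • v) v w := fun w => by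
    simpa using ((hasDerivAt_id w).smul_const v).const_add x
  have hder : ∀ w ∈ Metric.closedBall (0 : ℂ) (δ / (2 * ‖v‖)),
      HasDerivAt (fun w : ℂ => f (x + w • v)) (fderiv ℂ f (x + w • v) v) w := fun w hw =>
    ((hf.differentiableAt (hD.mem_nhds (hmem w hw))).hasFDerivAt).comp_hasDerivAt w (hline w)
  have hdc : DiffContOnCl ℂ (fun w : ℂ => f (x + w • v))
      (Metric.ball (0 : ℂ) (δ / (2 * ‖v‖))) := by
    apply DifferentiableOn.diffContOnCl
    rw [closure_ball _ hR.ne']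
    exact fun w hw => (hder w hw).differentiableAt.differentiableWithinAt
  have key := Complex.norm_deriv_le_of_forall_mem_sphere_norm_le hR hdc (C := 1)
    fun w hw => hb _ (hmem w (Metric.sphere_subset_closedBall hw))
  rw [(hder 0 (Metric.mem_closedBall_self hR.le)).deriv] at key
  simp only [zero_smul, add_zero] at key
  calc _ ≤ _ := key
    _ = _ := by field_simp

/-- The test function is `y ↦ y / B`. With the previous bound this compares the Carathéodory length
with the norm from both sides. -/
theorem CaratheodoryLE.norm_le {D : Set E} {x v : E} {lam B : ℝ} (h : CaratheodoryLE D x v lam)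
    (hB : 0 < B) (hDB : ∀ y ∈ D, ‖y‖ ≤ B) : ‖v‖ ≤ B * lam := by
  have := h (fun y => ((B : ℂ)⁻¹) • y) (by fun_prop) fun y hy => by
    rw [norm_smul, norm_inv, Complex.norm_real, Real.norm_of_nonneg hB.le, inv_mul_le_iff₀ hB]
    simpa using hDB y hy
  have hd : HasFDerivAt (fun y : E => ((B : ℂ)⁻¹) • y)
      (((B : ℂ)⁻¹) • ContinuousLinearMap.id ℂ E) x := (hasFDerivAt_id x).const_smul _
  rw [hd.fderiv] at this
  simp only [smul_apply, ContinuousLinearMap.id_apply, norm_smul, norm_inv,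
    Complex.norm_real, Real.norm_of_nonneg hB.le] at this
  rwa [inv_mul_le_iff₀ hB] at this

/-- A holomorphic self-map of `D` whose image keeps distance `δ` from the complement of `D`
contracts the infinitesimal Carathéodory metric. -/
theorem CaratheodoryLE.map {D : Set E} (hD : IsOpen D) {B δ : ℝ} (hB : 0 < B) (hδ : 0 < δ)
    (hDB : ∀ y ∈ D, ‖y‖ ≤ B) {F : E → E} (hF : DifferentiableOn ℂ F D)
    (hFD : ∀ y ∈ D, Metric.ball (F y) δ ⊆ D) {x v : E} (hx : x ∈ D) {lam : ℝ}
    (h : CaratheodoryLE D x v lam) :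
    CaratheodoryLE D (F x) (fderiv ℂ F x v) ((1 + δ / (4 * B))⁻¹ * lam) := by
  intro f hf hb
  set t := δ / (4 * B) with ht
  have ht0 : 0 < t := by positivity
  -- The perturbation `F + t (F - F x)` fixes the value at `x` but multiplies the derivative there
  -- by `1 + t`. It moves points by at most `2tB = δ/2`, so it still maps `D` into itself, and
  -- testing with it gains the factor `(1 + t)⁻¹`.
  have hmaps : ∀ y ∈ D, F y + (t : ℂ) • (F y - F x) ∈ D := by
    intro y hy
    apply hFD y hy
    have hFy : ‖F y‖ ≤ B := hDB _ (hFD y hy (Metric.mem_ball_self hδ))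
    have hFx : ‖F x‖ ≤ B := hDB _ (hFD x hx (Metric.mem_ball_self hδ))
    rw [mem_ball_iff_norm, add_sub_cancel_left, norm_smul, Complex.norm_real,
      Real.norm_of_nonneg ht0.le]
    calc t * ‖F y - F x‖ ≤ t * (B + B) := by
          gcongr; exact (norm_sub_le _ _).trans (add_le_add hFy hFx)
      _ = δ / 2 := by rw [ht]; field_simp; norm_num
      _ < δ := by linarith
  have hG : DifferentiableOn ℂ (fun y => F y + (t : ℂ) • (F y - F x)) D := by fun_prop
  have hGx := (hF.differentiableAt (hD.mem_nhds hx)).hasFDerivAt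
  have hGd : HasFDerivAt (fun y => F y + (t : ℂ) • (F y - F x))
      (fderiv ℂ F x + (t : ℂ) • fderiv ℂ F x) x :=
    hGx.add ((hGx.sub_const (F x)).const_smul (t : ℂ))
  have hFx : F x ∈ D := hFD x hx (Metric.mem_ball_self hδ)
  have hfd : HasFDerivAt f (fderiv ℂ f (F x)) (F x + (t : ℂ) • (F x - F x)) := by
    rw [sub_self, smul_zero, add_zero]
    exact (hf.differentiableAt (hD.mem_nhds hFx)).hasFDerivAt
  have key := h (f ∘ fun y => F y + (t : ℂ) • (F y - F x)) (hf.comp hG hmaps)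
    fun y hy => hb _ (hmaps y hy)
  have hcomp : HasFDerivAt (f ∘ fun y => F y + (t : ℂ) • (F y - F x))
      ((fderiv ℂ f (F x)).comp (fderiv ℂ F x + (t : ℂ) • fderiv ℂ F x)) x :=
    HasFDerivAt.comp x hfd hGd
  rw [hcomp.fderiv] at key
  have : (fderiv ℂ f (F x)).comp (fderiv ℂ F x + (t : ℂ) • fderiv ℂ F x) v
      = ((1 + t : ℝ) : ℂ) • fderiv ℂ f (F x) (fderiv ℂ F x v) := by
    simp [add_smul]
  rw [this, norm_smul, Complex.norm_real, Real.norm_of_nonneg (by positivity)] at key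
  rwa [le_inv_mul_iff₀ (by positivity)]

theorem CaratheodoryLE.iterate {D : Set E} (hD : IsOpen D) {B δ : ℝ} (hB : 0 < B) (hδ : 0 < δ)
    (hDB : ∀ y ∈ D, ‖y‖ ≤ B) {F : E → E} (hF : DifferentiableOn ℂ F D)
    (hFD : ∀ y ∈ D, Metric.ball (F y) δ ⊆ D) {x v : E} (hx : x ∈ D) {lam : ℝ}
    (h : CaratheodoryLE D x v lam) (n : ℕ) :
    F^[n] x ∈ D ∧ DifferentiableAt ℂ F^[n] x ∧
      CaratheodoryLE D (F^[n] x) (fderiv ℂ F^[n] x v) ((1 + δ / (4 * B))⁻¹ ^ n * lam) := by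
  induction n with
  | zero => exact ⟨hx, differentiableAt_id, by simpa [fderiv_fun_id] using h⟩
  | succ n ih =>
    obtain ⟨h1, h2, h3⟩ := ih
    have hFd := hF.differentiableAt (hD.mem_nhds h1)
    rw [Function.iterate_succ']
    refine ⟨hFD _ h1 (Metric.mem_ball_self hδ), hFd.comp x h2, ?_⟩
    rw [fderiv_comp x hFd h2, pow_succ', mul_assoc]
    exact h3.map hD hB hδ hDB hF hFD h1

/-- The **Earle–Hamilton fixed point theorem** on a bounded convex open set. -/
theorem earle_hamilton [CompleteSpace E] [NormedSpace ℝ E] {D : Set E} (hD : IsOpen D)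
    (hconv : Convex ℝ D) (hne : D.Nonempty) {B δ : ℝ} (hB : 0 < B) (hδ : 0 < δ)
    (hDB : ∀ y ∈ D, ‖y‖ ≤ B) {F : E → E} (hF : DifferentiableOn ℂ F D)
    (hFD : ∀ y ∈ D, Metric.ball (F y) δ ⊆ D) : ∃! x, x ∈ D ∧ F x = x := by
  set r := (1 + δ / (4 * B))⁻¹ with hr
  have hr0 : 0 ≤ r := by positivity
  have hr1 : r < 1 := inv_lt_one_of_one_lt₀ (by have : 0 < δ / (4 * B) := by positivity
                                                linarith)
  have hsub : {x | Metric.ball x δ ⊆ D} ⊆ D := fun x hx => hx (Metric.mem_ball_self hδ)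
  -- The norm comparison costs the factor `2B/δ` only once, whatever `n` is, while each iteration
  -- gains `r`.
  have hlip : ∀ n : ℕ, ∀ x ∈ {x | Metric.ball x δ ⊆ D}, ∀ y ∈ {x | Metric.ball x δ ⊆ D},
      ‖F^[n] y - F^[n] x‖ ≤ 2 * B / δ * r ^ n * ‖y - x‖ := by
    intro n x hx y hy
    refine (convex_setOf_ball_subset hconv δ).norm_image_sub_le_of_norm_fderiv_le (𝕜 := ℂ)
      (fun w hw => ?_) (fun w hw => ?_) hx hy
    · exact ((caratheodoryLE_of_ball_subset (v := 0) hD hδ hw).iterate hD hB hδ hDB hF hFD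
        (hsub hw) n).2.1
    · refine ContinuousLinearMap.opNorm_le_bound _ (by positivity) fun v => ?_
      have := ((caratheodoryLE_of_ball_subset (v := v) hD hδ hw).iterate hD hB hδ hDB hF hFD
        (hsub hw) n).2.2.norm_le hB hDB
      calc _ ≤ _ := this
        _ = _ := by rw [← hr]; ring
  have hlim : Filter.Tendsto (fun n => 2 * B / δ * r ^ n) Filter.atTop (nhds 0) := by
    simpa using (tendsto_pow_atTop_nhds_zero_of_lt_one hr0 hr1).const_mul (2 * B / δ)
  obtain ⟨x₀, hx₀⟩ := hne
  have hmem : ∀ n, F^[n] (F x₀) ∈ {x | Metric.ball x δ ⊆ D} := by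
    intro n
    induction n with
    | zero => exact hFD _ hx₀
    | succ n ih => rw [Function.iterate_succ_apply']; exact hFD _ (hsub ih)
  have hcau : CauchySeq fun n => F^[n] (F x₀) := by
    refine cauchySeq_of_le_geometric r (2 * B / δ * ‖F (F x₀) - F x₀‖) hr1 fun n => ?_
    rw [dist_comm, dist_eq_norm, Function.iterate_succ_apply]
    calc _ ≤ _ := hlip n _ (hmem 0) _ (hmem 1)
      _ = _ := by simp only [Function.iterate_zero, id, Function.iterate_one]; ring
  obtain ⟨x, hx⟩ := cauchySeq_tendsto_of_complete hcau
  have hxD : x ∈ {x | Metric.ball x δ ⊆ D} :=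
    (isClosed_setOf_ball_subset D δ).mem_of_tendsto hx (Filter.Eventually.of_forall hmem)
  have hfix : F x = x := by
    have hc : ContinuousAt F x :=
      (hF.differentiableAt (hD.mem_nhds (hsub hxD))).continuousAt
    have h1 : Filter.Tendsto (fun n => F^[n + 1] (F x₀)) Filter.atTop (nhds (F x)) := by
      simp only [Function.iterate_succ_apply']
      exact hc.tendsto.comp hx
    exact tendsto_nhds_unique h1 (hx.comp (Filter.tendsto_add_atTop_nat 1))
  refine ⟨x, ⟨hsub hxD, hfix⟩, ?_⟩
  rintro y ⟨hyD, hy⟩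
  -- Any fixed point lies in the image of `F`, hence at depth `δ`, where `hlip` applies.
  have hy' : y ∈ {x | Metric.ball x δ ⊆ D} := by
    have := hFD y hyD
    rwa [hy] at this
  have h : ∀ n : ℕ, ‖y - x‖ ≤ 2 * B / δ * r ^ n * ‖y - x‖ := fun n => by
    have := hlip n x hxD y hy'
    rwa [Function.iterate_fixed hy, Function.iterate_fixed hfix] at this
  have h0 : ‖y - x‖ ≤ 0 * ‖y - x‖ :=
    ge_of_tendsto (hlim.mul_const _) (Filter.Eventually.of_forall h)
  rw [zero_mul] at h0
  exact sub_eq_zero.1 (norm_le_zero_iff.1 h0)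

end EarleHamilton

end MDE

namespace MDE

/-! ### Imaginary parts and unique solvability in the upper half plane -/

section HalfPlane

open scoped ComplexOrder Matrix

variable {N : ℕ}

/-- The imaginary part `(M - M*) / (2i)` of a matrix. -/
noncomputable def imPart (M : Matrix (Fin N) (Fin N) ℂ) : Matrix (Fin N) (Fin N) ℂ :=
  (2 * Complex.I)⁻¹ • (M - Mᴴ)

theorem isHermitian_imPart (M : Matrix (Fin N) (Fin N) ℂ) : (imPart M).IsHermitian := by
  unfold imPart Matrix.IsHermitian
  rw [Matrix.conjTranspose_smul, Matrix.conjTranspose_sub, Matrix.conjTranspose_conjTranspose,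
    ← neg_sub M, smul_neg, ← neg_smul]
  congr 1
  simp

/-- Polarization: `2A = (A + 1)² - A² - 1`, and the square of a Hermitian matrix is positive
semidefinite. -/
theorem isHermitian_of_positivityPreserving
    {S : Matrix (Fin N) (Fin N) ℂ →ₗ[ℂ] Matrix (Fin N) (Fin N) ℂ} (hS : PositivityPreserving S)
    {A : Matrix (Fin N) (Fin N) ℂ} (hA : A.IsHermitian) : (S A).IsHermitian := by
  have hsq : ∀ B : Matrix (Fin N) (Fin N) ℂ, B.IsHermitian → (S (B * B)).IsHermitian := by
    intro B hB
    have := (hS _ (Matrix.posSemidef_conjTranspose_mul_self B)).isHermitian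
    rwa [hB.eq] at this
  have hone : (1 : Matrix (Fin N) (Fin N) ℂ).IsHermitian := Matrix.isHermitian_one
  have h := ((hsq _ (hA.add hone)).sub (hsq _ hA)).sub (hsq _ hone)
  have he : S ((A + 1) * (A + 1)) - S (A * A) - S (1 * 1) = (2 : ℂ) • S A := by
    rw [← map_sub, ← map_sub, ← map_smul]
    congr 1
    rw [two_smul]
    noncomm_ring
  rw [he] at h
  have h2 : S A = (2⁻¹ : ℂ) • ((2 : ℂ) • S A) := by rw [smul_smul]; norm_num
  rw [h2]
  unfold Matrix.IsHermitian at h ⊢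
  rw [Matrix.conjTranspose_smul, h]
  simp

theorem conjTranspose_apply
    {S : Matrix (Fin N) (Fin N) ℂ →ₗ[ℂ] Matrix (Fin N) (Fin N) ℂ} (hS : PositivityPreserving S)
    (A : Matrix (Fin N) (Fin N) ℂ) : (S A)ᴴ = S Aᴴ := by
  have h1 := isHermitian_of_positivityPreserving hS (isHermitian_imPart A)
  have h2 := isHermitian_of_positivityPreserving hS (Matrix.isHermitian_add_transpose_self A)
  unfold Matrix.IsHermitian at h1 h2
  unfold imPart at h1
  rw [map_smul, map_sub, Matrix.conjTranspose_smul, Matrix.conjTranspose_sub] at h1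
  rw [map_add, Matrix.conjTranspose_add] at h2
  have h3 : (S A)ᴴ - (S Aᴴ)ᴴ = S Aᴴ - S A := by
    have hI : star ((2 * Complex.I)⁻¹) = -(2 * Complex.I)⁻¹ := by simp
    rw [hI, neg_smul, ← smul_neg] at h1
    have := smul_right_injective _ (r := (2 * Complex.I)⁻¹) (by simp) h1
    rw [neg_eq_iff_eq_neg] at this
    rw [this]; abel
  have h4 : (2 : ℂ) • (S A)ᴴ = (2 : ℂ) • S Aᴴ := by
    rw [two_smul, two_smul]
    calc (S A)ᴴ + (S A)ᴴ = ((S A)ᴴ + (S Aᴴ)ᴴ) + ((S A)ᴴ - (S Aᴴ)ᴴ) := by abel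
      _ = _ := by rw [h2, h3]; abel
  exact smul_right_injective _ (two_ne_zero' ℂ) h4

theorem apply_imPart
    {S : Matrix (Fin N) (Fin N) ℂ →ₗ[ℂ] Matrix (Fin N) (Fin N) ℂ} (hS : PositivityPreserving S)
    (A : Matrix (Fin N) (Fin N) ℂ) : S (imPart A) = imPart (S A) := by
  rw [imPart, imPart, map_smul, map_sub, conjTranspose_apply hS]

/-- The form `Im ⟨x, M x⟩`. -/
noncomputable def imForm (M : Matrix (Fin N) (Fin N) ℂ) (x : EuclideanSpace ℂ (Fin N)) : ℝ :=
  (inner ℂ x (Matrix.toEuclideanCLM (n := Fin N) (𝕜 := ℂ) M x)).im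

theorem inner_toEuclideanCLM (M : Matrix (Fin N) (Fin N) ℂ) (x : EuclideanSpace ℂ (Fin N)) :
    inner ℂ x (Matrix.toEuclideanCLM (n := Fin N) (𝕜 := ℂ) M x)
      = star x.ofLp ⬝ᵥ (M *ᵥ x.ofLp) := by
  rw [EuclideanSpace.inner_eq_star_dotProduct, Matrix.ofLp_toEuclideanCLM, dotProduct_comm]

theorem dotProduct_imPart (M : Matrix (Fin N) (Fin N) ℂ) (x : EuclideanSpace ℂ (Fin N)) :
    star x.ofLp ⬝ᵥ (imPart M *ᵥ x.ofLp) = (imForm M x : ℂ) := by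
  have hconj : star x.ofLp ⬝ᵥ (Mᴴ *ᵥ x.ofLp) = star (star x.ofLp ⬝ᵥ (M *ᵥ x.ofLp)) := by
    rw [Matrix.star_dotProduct, Matrix.star_mulVec, Matrix.dotProduct_mulVec,
      Matrix.conjTranspose_conjTranspose]
  rw [imForm, inner_toEuclideanCLM, imPart, Matrix.smul_mulVec, Matrix.sub_mulVec,
    dotProduct_smul, dotProduct_sub, hconj]
  generalize star x.ofLp ⬝ᵥ (M *ᵥ x.ofLp) = w
  change (2 * Complex.I)⁻¹ * (w - (starRingEnd ℂ) w) = _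
  rw [Complex.sub_conj, Complex.ofReal_mul, Complex.ofReal_ofNat]
  field_simp

theorem posSemidef_imPart_iff (M : Matrix (Fin N) (Fin N) ℂ) :
    (imPart M).PosSemidef ↔ ∀ x, 0 ≤ imForm M x := by
  rw [Matrix.posSemidef_iff_dotProduct_mulVec]
  constructor
  · intro h x
    have := h.2 x.ofLp
    rwa [dotProduct_imPart, Complex.zero_le_real] at this
  · refine fun h => ⟨isHermitian_imPart M, fun x => ?_⟩
    have := dotProduct_imPart M (WithLp.toLp 2 x)
    simp only at this
    rw [this, Complex.zero_le_real]
    exact h _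

theorem hasPosIm_iff (M : Matrix (Fin N) (Fin N) ℂ) :
    HasPosIm M ↔ ∀ x ≠ 0, 0 < imForm M x := by
  change (imPart M).PosDef ↔ _
  rw [Matrix.posDef_iff_dotProduct_mulVec]
  constructor
  · intro h x hx
    have := h.2 (x := x.ofLp) (by simpa using hx)
    rwa [dotProduct_imPart, Complex.zero_lt_real] at this
  · refine fun h => ⟨isHermitian_imPart M, fun x hx => ?_⟩
    have := dotProduct_imPart M (WithLp.toLp 2 x)
    simp only at this
    rw [this, Complex.zero_lt_real]
    exact h _ (by simpa using hx)

theorem imForm_apply_nonneg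
    {S : Matrix (Fin N) (Fin N) ℂ →ₗ[ℂ] Matrix (Fin N) (Fin N) ℂ} (hS : PositivityPreserving S)
    {M : Matrix (Fin N) (Fin N) ℂ} (hM : ∀ x, 0 ≤ imForm M x) (x : EuclideanSpace ℂ (Fin N)) :
    0 ≤ imForm (S M) x := by
  have := hS _ ((posSemidef_imPart_iff M).2 hM)
  rw [apply_imPart hS] at this
  exact (posSemidef_imPart_iff _).1 this x

theorem imForm_add (A B : Matrix (Fin N) (Fin N) ℂ) (x : EuclideanSpace ℂ (Fin N)) :
    imForm (A + B) x = imForm A x + imForm B x := by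
  simp [imForm]

theorem imForm_real_smul (a : ℝ) (A : Matrix (Fin N) (Fin N) ℂ) (x : EuclideanSpace ℂ (Fin N)) :
    imForm ((a : ℂ) • A) x = a * imForm A x := by
  rw [imForm, imForm, map_smul, smul_apply, inner_smul_right, Complex.im_ofReal_mul]

theorem imForm_smul_one (z : ℂ) (x : EuclideanSpace ℂ (Fin N)) :
    imForm (z • (1 : Matrix (Fin N) (Fin N) ℂ)) x = z.im * ‖x‖ ^ 2 := by
  have : ((‖x‖ : ℂ) ^ 2).re = ‖x‖ ^ 2 := by norm_cast
  have h' : ((‖x‖ : ℂ) ^ 2).im = 0 := by norm_cast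
  simp only [imForm, map_smul, map_one, smul_apply,
    one_apply_eq_self, inner_smul_right, inner_self_eq_norm_sq_to_K]
  simp [this, h']

open scoped Matrix.Norms.L2Operator

theorem norm_toEuclideanCLM_le (A : Matrix (Fin N) (Fin N) ℂ) (x : EuclideanSpace ℂ (Fin N)) :
    ‖Matrix.toEuclideanCLM (n := Fin N) (𝕜 := ℂ) A x‖ ≤ ‖A‖ * ‖x‖ := by
  rw [← Matrix.l2_opNorm_toEuclideanCLM]
  exact ContinuousLinearMap.le_opNorm _ _

theorem abs_imForm_le (A : Matrix (Fin N) (Fin N) ℂ) (x : EuclideanSpace ℂ (Fin N)) :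
    |imForm A x| ≤ ‖A‖ * ‖x‖ ^ 2 :=
  calc |imForm A x| ≤ ‖inner ℂ x (Matrix.toEuclideanCLM (n := Fin N) (𝕜 := ℂ) A x)‖ :=
        Complex.abs_im_le_norm _
    _ ≤ ‖x‖ * ‖Matrix.toEuclideanCLM (n := Fin N) (𝕜 := ℂ) A x‖ := norm_inner_le_norm _ _
    _ ≤ ‖x‖ * (‖A‖ * ‖x‖) := by gcongr; exact norm_toEuclideanCLM_le A x
    _ = _ := by ring

/-! ### Inverses of matrices with imaginary part at least `η` -/

section Accretive

variable {B : Matrix (Fin N) (Fin N) ℂ} {η : ℝ}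

theorem mul_norm_le_of_le_imForm (hB : ∀ x, η * ‖x‖ ^ 2 ≤ imForm B x)
    (x : EuclideanSpace ℂ (Fin N)) :
    η * ‖x‖ ≤ ‖Matrix.toEuclideanCLM (n := Fin N) (𝕜 := ℂ) B x‖ := by
  rcases eq_or_ne x 0 with rfl | hx
  · simp
  have hx' : 0 < ‖x‖ := norm_pos_iff.2 hx
  have h : η * ‖x‖ ^ 2 ≤ ‖x‖ * ‖Matrix.toEuclideanCLM (n := Fin N) (𝕜 := ℂ) B x‖ :=
    calc _ ≤ imForm B x := hB x
      _ ≤ ‖inner ℂ x (Matrix.toEuclideanCLM (n := Fin N) (𝕜 := ℂ) B x)‖ :=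
        (le_abs_self _).trans (Complex.abs_im_le_norm _)
      _ ≤ _ := norm_inner_le_norm _ _
  nlinarith

theorem isUnit_of_le_imForm (hη : 0 < η) (hB : ∀ x, η * ‖x‖ ^ 2 ≤ imForm B x) : IsUnit B := by
  rw [← Matrix.mulVec_injective_iff_isUnit]
  refine (injective_iff_map_eq_zero (Matrix.mulVecLin B)).2 fun x hx => ?_
  have h := mul_norm_le_of_le_imForm hB (WithLp.toLp 2 x)
  rw [Matrix.toEuclideanCLM_toLp] at h
  have hx' : B *ᵥ x = 0 := hx
  rw [hx'] at h
  have h0 : ‖WithLp.toLp 2 x‖ ≤ 0 := by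
    have : η * ‖WithLp.toLp 2 x‖ ≤ 0 := by simpa using h
    by_contra hc
    push Not at hc
    nlinarith
  simpa using h0

theorem toEuclideanCLM_apply_inv (hB : IsUnit B) (y : EuclideanSpace ℂ (Fin N)) :
    Matrix.toEuclideanCLM (n := Fin N) (𝕜 := ℂ) B
      (Matrix.toEuclideanCLM (n := Fin N) (𝕜 := ℂ) B⁻¹ y) = y := by
  rw [← mul_apply_eq_comp, ← map_mul,
    Matrix.mul_nonsing_inv _ ((Matrix.isUnit_iff_isUnit_det B).1 hB), map_one,
    one_apply_eq_self]

theorem norm_inv_le_of_le_imForm (hη : 0 < η) (hB : ∀ x, η * ‖x‖ ^ 2 ≤ imForm B x) :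
    ‖B⁻¹‖ ≤ η⁻¹ := by
  rw [← Matrix.l2_opNorm_toEuclideanCLM]
  refine ContinuousLinearMap.opNorm_le_bound _ (by positivity) fun y => ?_
  have := mul_norm_le_of_le_imForm hB (Matrix.toEuclideanCLM (n := Fin N) (𝕜 := ℂ) B⁻¹ y)
  rw [toEuclideanCLM_apply_inv (isUnit_of_le_imForm hη hB)] at this
  rwa [le_inv_mul_iff₀ hη]

/-- With `y = B x` one has `Im ⟨y, -B⁻¹ y⟩ = Im ⟨x, B x⟩` and `‖y‖ ≤ b ‖x‖`. This keeps the image of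
the fixed point map away from the boundary of the half plane. -/
theorem le_imForm_neg_inv {b : ℝ} (hb : 0 < b) (hBb : ‖B‖ ≤ b) (hη : 0 < η)
    (hB : ∀ x, η * ‖x‖ ^ 2 ≤ imForm B x) (y : EuclideanSpace ℂ (Fin N)) :
    η / b ^ 2 * ‖y‖ ^ 2 ≤ imForm (-B⁻¹) y := by
  set x := Matrix.toEuclideanCLM (n := Fin N) (𝕜 := ℂ) B⁻¹ y with hx
  have hy : Matrix.toEuclideanCLM (n := Fin N) (𝕜 := ℂ) B x = y :=
    toEuclideanCLM_apply_inv (isUnit_of_le_imForm hη hB) y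
  have h1 : imForm (-B⁻¹) y = imForm B x := by
    rw [imForm, imForm, map_neg, neg_apply, inner_neg_right, ← hx, hy,
      ← inner_conj_symm, Complex.neg_im, Complex.conj_im, neg_neg]
  have h2 : ‖y‖ ≤ b * ‖x‖ := by
    rw [← hy]
    exact (norm_toEuclideanCLM_le B x).trans (by gcongr)
  rw [h1]
  calc η / b ^ 2 * ‖y‖ ^ 2 ≤ η / b ^ 2 * (b * ‖x‖) ^ 2 := by gcongr
    _ = η * ‖x‖ ^ 2 := by field_simp
    _ ≤ _ := hB x

end Accretive

/-- The part of the matrix upper half plane in which the norm is less than `C`. -/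
def halfPlane (N : ℕ) (C : ℝ) : Set (Matrix (Fin N) (Fin N) ℂ) :=
  {M | (∃ δ > 0, ∀ x, δ * ‖x‖ ^ 2 ≤ imForm M x) ∧ ‖M‖ < C}

theorem ball_subset_halfPlane {M : Matrix (Fin N) (Fin N) ℂ} {δ ε C : ℝ}
    (hM : ∀ x, δ * ‖x‖ ^ 2 ≤ imForm M x) (hε : ε < δ) (hC : ‖M‖ + ε ≤ C) :
    Metric.ball M ε ⊆ halfPlane N C := by
  intro A hA
  rw [mem_ball_iff_norm] at hA
  refine ⟨⟨δ - ε, by linarith, fun x => ?_⟩, ?_⟩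
  · have h1 := abs_imForm_le (A - M) x
    have h2 : imForm A x = imForm M x + imForm (A - M) x := by rw [← imForm_add]; congr 1; abel
    have h3 := hM x
    have h4 := neg_abs_le (imForm (A - M) x)
    have h5 : ‖A - M‖ * ‖x‖ ^ 2 ≤ ε * ‖x‖ ^ 2 := by gcongr
    rw [h2]; linarith
  · have : A = M + (A - M) := by abel
    rw [this]
    exact (norm_add_le _ _).trans_lt (by linarith)

theorem isOpen_halfPlane (N : ℕ) (C : ℝ) : IsOpen (halfPlane N C) := by
  rw [Metric.isOpen_iff]
  rintro M ⟨⟨δ, hδ, hM⟩, hC⟩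
  refine ⟨min (δ / 2) (C - ‖M‖), lt_min (by linarith) (by linarith),
    ball_subset_halfPlane hM ?_ ?_⟩
  · exact (min_le_left _ _).trans_lt (by linarith)
  · linarith [min_le_right (δ / 2) (C - ‖M‖)]

theorem convex_halfPlane (N : ℕ) (C : ℝ) : Convex ℝ (halfPlane N C) := by
  rintro A ⟨⟨δ, hδ, hA⟩, hAC⟩ B ⟨⟨δ', hδ', hB⟩, hBC⟩ a b ha hb hab
  rw [← Complex.coe_smul a A, ← Complex.coe_smul b B]
  refine ⟨⟨min δ δ', lt_min hδ hδ', fun x => ?_⟩, ?_⟩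
  · rw [imForm_add, imForm_real_smul, imForm_real_smul]
    have h1 : min δ δ' * ‖x‖ ^ 2 ≤ imForm A x :=
      le_trans (by gcongr; exact min_le_left _ _) (hA x)
    have h2 : min δ δ' * ‖x‖ ^ 2 ≤ imForm B x :=
      le_trans (by gcongr; exact min_le_right _ _) (hB x)
    calc min δ δ' * ‖x‖ ^ 2 = a * (min δ δ' * ‖x‖ ^ 2) + b * (min δ δ' * ‖x‖ ^ 2) := by
          rw [← add_mul, hab, one_mul]
      _ ≤ _ := by gcongr
  · refine (norm_add_le _ _).trans_lt ?_
    rw [norm_smul, norm_smul, Complex.norm_real, Complex.norm_real, Real.norm_of_nonneg ha,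
      Real.norm_of_nonneg hb]
    rcases ha.eq_or_lt with rfl | ha'
    · obtain rfl : b = 1 := by linarith
      simpa using hBC
    · have h1 : a * ‖A‖ < a * C := by gcongr
      have h2 : b * ‖B‖ ≤ b * C := by gcongr
      calc _ < a * C + b * C := by linarith
        _ = C := by rw [← add_mul, hab, one_mul]

theorem le_imForm_add_apply
    {S : Matrix (Fin N) (Fin N) ℂ →ₗ[ℂ] Matrix (Fin N) (Fin N) ℂ} (hS : PositivityPreserving S)
    (z : ℂ) {M : Matrix (Fin N) (Fin N) ℂ} (hM : ∀ x, 0 ≤ imForm M x)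
    (x : EuclideanSpace ℂ (Fin N)) :
    z.im * ‖x‖ ^ 2 ≤ imForm (z • (1 : Matrix (Fin N) (Fin N) ℂ) + S M) x := by
  rw [imForm_add, imForm_smul_one]
  linarith [imForm_apply_nonneg hS hM x]

theorem solvesMDE_iff_of_isUnit
    {S : Matrix (Fin N) (Fin N) ℂ →ₗ[ℂ] Matrix (Fin N) (Fin N) ℂ} {z : ℂ}
    {M : Matrix (Fin N) (Fin N) ℂ}
    (h : IsUnit (z • (1 : Matrix (Fin N) (Fin N) ℂ) + S M)) :
    SolvesMDE S z M ↔ -(z • (1 : Matrix (Fin N) (Fin N) ℂ) + S M)⁻¹ = M := by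
  unfold SolvesMDE
  set B := z • (1 : Matrix (Fin N) (Fin N) ℂ) + S M
  have hdet := (Matrix.isUnit_iff_isUnit_det B).1 h
  constructor
  · rintro ⟨hu, he⟩
    have hMdet := (Matrix.isUnit_iff_isUnit_det M).1 hu
    have : B * (-M) = 1 := by
      rw [← he, neg_mul_neg, Matrix.nonsing_inv_mul _ hMdet]
    rw [Matrix.inv_eq_right_inv this, neg_neg]
  · intro he
    have hMB : M * (-B) = 1 := by
      rw [← he, neg_mul_neg, Matrix.nonsing_inv_mul _ hdet]
    refine ⟨IsUnit.of_mul_eq_one _ hMB, ?_⟩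
    rw [Matrix.inv_eq_right_inv hMB, neg_neg]

/-- A matrix with nonnegative imaginary part that solves the MDE in the upper half plane is bounded
by `1 / Im z`, and its imaginary part is bounded away from `0`. -/
theorem SolvesMDE.bounds
    {S : Matrix (Fin N) (Fin N) ℂ →ₗ[ℂ] Matrix (Fin N) (Fin N) ℂ} (hS : PositivityPreserving S)
    {z : ℂ} (hz : 0 < z.im) {M : Matrix (Fin N) (Fin N) ℂ} (h : SolvesMDE S z M)
    (hM : ∀ x, 0 ≤ imForm M x) :
    ‖M‖ ≤ (z.im)⁻¹ ∧ ∃ δ > 0, ∀ x, δ * ‖x‖ ^ 2 ≤ imForm M x := by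
  have hB := le_imForm_add_apply hS z hM
  have he := (solvesMDE_iff_of_isUnit (isUnit_of_le_imForm hz hB)).1 h
  refine ⟨?_, ?_⟩
  · conv_lhs => rw [← he]
    rw [norm_neg]
    exact norm_inv_le_of_le_imForm hz hB
  · have hb : 0 < ‖z • (1 : Matrix (Fin N) (Fin N) ℂ) + S M‖ + 1 := by positivity
    refine ⟨z.im / (‖z • (1 : Matrix (Fin N) (Fin N) ℂ) + S M‖ + 1) ^ 2, by positivity,
      fun x => ?_⟩
    conv_rhs => rw [← he]
    exact le_imForm_neg_inv hb (by linarith) hz hB x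

theorem existsUnique_solvesMDE
    {S : Matrix (Fin N) (Fin N) ℂ →ₗ[ℂ] Matrix (Fin N) (Fin N) ℂ} (hS : PositivityPreserving S)
    {z : ℂ} (hz : 0 < z.im) :
    ∃! M : Matrix (Fin N) (Fin N) ℂ, SolvesMDE S z M ∧ HasPosIm M := by
  set η := z.im with hη
  -- Twice the a priori bound `η⁻¹`, so that images keep distance `η⁻¹` from the sphere of radius
  -- `C`.
  set C := 2 * η⁻¹ with hC
  have hC0 : 0 < C := by positivity
  set L := LinearMap.toContinuousLinearMap S with hL
  set b := ‖z‖ * ‖(1 : Matrix (Fin N) (Fin N) ℂ)‖ + ‖L‖ * C + 1 with hb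
  have hb0 : 0 < b := by positivity
  set F : Matrix (Fin N) (Fin N) ℂ → Matrix (Fin N) (Fin N) ℂ :=
    fun M => -(z • (1 : Matrix (Fin N) (Fin N) ℂ) + S M)⁻¹ with hF
  have hnn : ∀ M ∈ halfPlane N C, ∀ x, 0 ≤ imForm M x := by
    rintro M ⟨⟨δ, hδ, hM⟩, -⟩ x
    exact le_trans (by positivity) (hM x)
  have hacc : ∀ M ∈ halfPlane N C, ∀ x,
      η * ‖x‖ ^ 2 ≤ imForm (z • (1 : Matrix (Fin N) (Fin N) ℂ) + S M) x := fun M hM =>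
    le_imForm_add_apply hS z (hnn M hM)
  have hunit : ∀ M ∈ halfPlane N C, IsUnit (z • (1 : Matrix (Fin N) (Fin N) ℂ) + S M) :=
    fun M hM => isUnit_of_le_imForm hz (hacc M hM)
  have hdiff : DifferentiableOn ℂ F (halfPlane N C) := by
    intro M hM
    apply DifferentiableAt.differentiableWithinAt
    have h1 : DifferentiableAt ℂ (fun M => z • (1 : Matrix (Fin N) (Fin N) ℂ) + S M) M :=
      L.differentiableAt.const_add _
    have h2 : F = fun M => -(Ring.inverse (z • (1 : Matrix (Fin N) (Fin N) ℂ) + S M)) := by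
      funext A
      simp only [hF, Matrix.nonsing_inv_eq_ringInverse]
    rw [h2]
    exact ((differentiableAt_inverse (𝕜 := ℂ) (hunit M hM)).comp M h1).neg
  have hnorm : ∀ M ∈ halfPlane N C, ‖z • (1 : Matrix (Fin N) (Fin N) ℂ) + S M‖ ≤ b := by
    intro M hM
    have h1 : ‖S M‖ ≤ ‖L‖ * C := (L.le_opNorm M).trans (by gcongr; exact hM.2.le)
    have h2 : ‖z • (1 : Matrix (Fin N) (Fin N) ℂ)‖ ≤ ‖z‖ * ‖(1 : Matrix (Fin N) (Fin N) ℂ)‖ :=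
      norm_smul_le _ _
    linarith [norm_add_le (z • (1 : Matrix (Fin N) (Fin N) ℂ)) (S M)]
  have hmaps : ∀ M ∈ halfPlane N C,
      Metric.ball (F M) (min (η / b ^ 2 / 2) η⁻¹) ⊆ halfPlane N C := by
    intro M hM
    have hpos : 0 < η / b ^ 2 := by positivity
    refine ball_subset_halfPlane
      (le_imForm_neg_inv hb0 (hnorm M hM) hz (hacc M hM)) ?_ ?_
    · exact (min_le_left _ _).trans_lt (by linarith)
    · have h1 : ‖F M‖ ≤ η⁻¹ := by
        rw [hF]; simp only [norm_neg]
        exact norm_inv_le_of_le_imForm hz (hacc M hM)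
      linarith [min_le_right (η / b ^ 2 / 2) η⁻¹]
  have hne : (halfPlane N C).Nonempty := by
    -- The `+ 1` keeps the denominator positive for `N = 0`, where the identity has norm zero.
    set a := (C / 2) / (‖(1 : Matrix (Fin N) (Fin N) ℂ)‖ + 1) with ha
    have ha0 : 0 < a := by positivity
    refine ⟨(a * Complex.I) • 1, ⟨a, ha0, fun x => ?_⟩, ?_⟩
    · rw [imForm_smul_one]; simp
    · refine (norm_smul_le _ _).trans_lt ?_
      rw [norm_mul, Complex.norm_I, mul_one, Complex.norm_real, Real.norm_of_nonneg ha0.le]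
      calc a * ‖(1 : Matrix (Fin N) (Fin N) ℂ)‖
          ≤ a * (‖(1 : Matrix (Fin N) (Fin N) ℂ)‖ + 1) := by gcongr; linarith
        _ = C / 2 := by rw [ha]; field_simp
        _ < C := by linarith
  obtain ⟨M, ⟨hM, hfix⟩, huniq⟩ := earle_hamilton (isOpen_halfPlane N C) (convex_halfPlane N C)
    hne hC0 (lt_min (by positivity) (by positivity)) (fun y hy => hy.2.le) hdiff hmaps
  refine ⟨M, ⟨(solvesMDE_iff_of_isUnit (hunit M hM)).2 hfix, ?_⟩, ?_⟩
  · rw [hasPosIm_iff]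
    intro x hx
    obtain ⟨⟨δ, hδ, h⟩, -⟩ := hM
    exact lt_of_lt_of_le (by have := norm_pos_iff.2 hx; positivity) (h x)
  · rintro A ⟨hA, hpos⟩
    -- Uniqueness among all solutions with positive imaginary part: the a priori bounds place any of
    -- them in `halfPlane N C`.
    have hA0 : ∀ x, 0 ≤ imForm A x := (posSemidef_imPart_iff A).1 hpos.posSemidef
    obtain ⟨h1, h2⟩ := hA.bounds hS hz hA0
    have hA' : A ∈ halfPlane N C := ⟨h2, h1.trans_lt (by
      have : 0 < η⁻¹ := by positivity
      linarith)⟩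
    exact huniq A ⟨hA', (solvesMDE_iff_of_isUnit (hunit A hA')).1 hA⟩

end HalfPlane

end MDE

namespace MDE

/-! ### Exponentially weighted norms and the action of `S` on them -/

section WeightedBounds

open scoped Matrix

variable {N : ℕ}

theorem idxDist_comm (x y : Fin N) : idxDist x y = idxDist y x := abs_sub_comm _ _

theorem idxDist_triangle (x y z : Fin N) : idxDist x z ≤ idxDist x y + idxDist y z :=
  abs_sub_le _ _ _

theorem idxDist_nonneg (x y : Fin N) : 0 ≤ idxDist x y := abs_nonneg _

theorem idxDist_self (x : Fin N) : idxDist x x = 0 := by simp [idxDist]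

theorem exists_sum_exp_idxDist_le {d : ℝ} (hd : 0 < d) :
    ∃ G : ℝ, 0 < G ∧ ∀ (N : ℕ) (x : Fin N), ∑ t, Real.exp (-d * idxDist x t) ≤ G := by
  have hsum : Summable fun n : ℤ => Real.exp (-d * |(n : ℝ)|) := by
    have h : Summable fun n : ℕ => Real.exp (-d * |((n : ℤ) : ℝ)|) := by
      have := summable_geometric_of_lt_one (Real.exp_pos (-d)).le
        (by rw [← Real.exp_zero]; exact Real.exp_lt_exp.2 (by linarith))
      refine this.congr fun n => ?_
      rw [← Real.exp_nat_mul, Int.cast_natCast, Nat.abs_cast, mul_comm]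
    exact Summable.of_nat_of_neg h (by simpa using h)
  refine ⟨∑' n : ℤ, Real.exp (-d * |(n : ℝ)|),
    hsum.tsum_pos (fun _ => (Real.exp_pos _).le) 0 (Real.exp_pos _), fun N x => ?_⟩
  let φ : Fin N → ℤ := fun t => ((x : ℕ) : ℤ) - ((t : ℕ) : ℤ)
  have hφ : Function.Injective φ := fun s t h => by
    apply Fin.ext
    simp only [φ] at h
    omega
  calc ∑ t, Real.exp (-d * idxDist x t)
      = ∑ n ∈ Finset.univ.map ⟨φ, hφ⟩, Real.exp (-d * |(n : ℝ)|) := by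
        rw [Finset.sum_map]
        refine Finset.sum_congr rfl fun t _ => ?_
        simp [φ, idxDist]
    _ ≤ _ := hsum.sum_le_tsum _ fun _ _ => (Real.exp_pos _).le

/-- The entries of `A` are bounded by `b` with exponential weights. -/
def EntryBound (l : ℝ) (A : Matrix (Fin N) (Fin N) ℂ) (b : ℝ) : Prop :=
  ∀ x t, Real.exp (idxDist x t / l) * ‖A x t‖ ≤ b

/-- The exponentially weighted row sums of `A` are bounded by `b`. -/
def RowBound (l : ℝ) (A : Matrix (Fin N) (Fin N) ℂ) (b : ℝ) : Prop :=
  ∀ x, ∑ t, Real.exp (idxDist x t / l) * ‖A x t‖ ≤ b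

/-- The exponentially weighted row and column sums of `A` are bounded by `b`. -/
def WeightedBound (l : ℝ) (A : Matrix (Fin N) (Fin N) ℂ) (b : ℝ) : Prop :=
  RowBound l A b ∧ RowBound l Aᴴ b

variable {l : ℝ} {A B : Matrix (Fin N) (Fin N) ℂ} {a b : ℝ}

theorem RowBound.entryBound (h : RowBound l A b) : EntryBound l A b := fun x t =>
  (Finset.single_le_sum (f := fun t => Real.exp (idxDist x t / l) * ‖A x t‖)
    (fun _ _ => by positivity) (Finset.mem_univ t)).trans (h x)

theorem EntryBound.conjTranspose (h : EntryBound l A b) : EntryBound l Aᴴ b := fun x t => by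
  rw [Matrix.conjTranspose_apply, norm_star, idxDist_comm]
  exact h t x

theorem EntryBound.matLNorm_le (hb : 0 ≤ b) (h : EntryBound l A b) : matLNorm l A ≤ b :=
  Real.iSup_le (fun p => h p.1 p.2) hb

theorem EntryBound.norm_le (hl : 0 < l) (h : EntryBound l A b) (x t : Fin N) : ‖A x t‖ ≤ b :=
  (le_mul_of_one_le_left (norm_nonneg _)
    (Real.one_le_exp (div_nonneg (idxDist_nonneg x t) hl.le))).trans (h x t)

theorem RowBound.mono (h : RowBound l A a) (hab : a ≤ b) : RowBound l A b :=
  fun x => (h x).trans hab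

theorem RowBound.add (hA : RowBound l A a) (hB : RowBound l B b) :
    RowBound l (A + B) (a + b) := fun x =>
  calc _ ≤ ∑ t, (Real.exp (idxDist x t / l) * ‖A x t‖ + Real.exp (idxDist x t / l) * ‖B x t‖) := by
        refine Finset.sum_le_sum fun t _ => ?_
        rw [← mul_add, Matrix.add_apply]
        gcongr
        exact norm_add_le _ _
    _ ≤ _ := by rw [Finset.sum_add_distrib]; exact add_le_add (hA x) (hB x)

theorem rowBound_zero : RowBound l (0 : Matrix (Fin N) (Fin N) ℂ) 0 := fun x => by simp

theorem RowBound.sum {ι : Type*} {s : Finset ι} {A : ι → Matrix (Fin N) (Fin N) ℂ} {b : ι → ℝ}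
    (h : ∀ i ∈ s, RowBound l (A i) (b i)) : RowBound l (∑ i ∈ s, A i) (∑ i ∈ s, b i) := by
  classical
  induction s using Finset.induction_on with
  | empty => simpa using rowBound_zero
  | insert i s hi ih =>
    rw [Finset.sum_insert hi, Finset.sum_insert hi]
    exact (h i (Finset.mem_insert_self i s)).add
      (ih fun j hj => h j (Finset.mem_insert_of_mem hj))

theorem RowBound.smul (h : RowBound l A b) (w : ℂ) : RowBound l (w • A) (‖w‖ * b) := fun x =>
  calc _ = ‖w‖ * ∑ t, Real.exp (idxDist x t / l) * ‖A x t‖ := by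
        rw [Finset.mul_sum]
        refine Finset.sum_congr rfl fun t _ => ?_
        rw [Matrix.smul_apply, norm_smul]; ring
    _ ≤ _ := by gcongr; exact h x

theorem RowBound.neg (h : RowBound l A b) : RowBound l (-A) b := by
  simpa using h.smul (-1)

theorem rowBound_one : RowBound l (1 : Matrix (Fin N) (Fin N) ℂ) 1 := fun x => by
  rw [Finset.sum_eq_single x]
  · simp [idxDist_self]
  · intro t _ ht
    simp [Matrix.one_apply_ne ht.symm]
  · simp

/-- The weight is submultiplicative along `x → y → t` by the triangle inequality, so weighted row
sums multiply with no loss in `l` or `N`. -/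
theorem RowBound.mul (hl : 0 < l) (hb : 0 ≤ b) (hA : RowBound l A a) (hB : RowBound l B b) :
    RowBound l (A * B) (a * b) := fun x =>
  calc _ ≤ ∑ t, ∑ y, (Real.exp (idxDist x y / l) * ‖A x y‖) *
          (Real.exp (idxDist y t / l) * ‖B y t‖) := by
        refine Finset.sum_le_sum fun t _ => ?_
        rw [Matrix.mul_apply]
        calc _ ≤ Real.exp (idxDist x t / l) * ∑ y, ‖A x y * B y t‖ := by
              gcongr; exact norm_sum_le _ _
          _ = ∑ y, Real.exp (idxDist x t / l) * (‖A x y‖ * ‖B y t‖) := by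
              simp only [Finset.mul_sum, norm_mul]
          _ ≤ ∑ y, (Real.exp (idxDist x y / l) * Real.exp (idxDist y t / l)) *
              (‖A x y‖ * ‖B y t‖) := by
              refine Finset.sum_le_sum fun y _ => ?_
              rw [← Real.exp_add, ← add_div]
              gcongr
              exact idxDist_triangle x y t
          _ = _ := Finset.sum_congr rfl fun y _ => by ring
    _ = ∑ y, (Real.exp (idxDist x y / l) * ‖A x y‖) *
          ∑ t, Real.exp (idxDist y t / l) * ‖B y t‖ := by
        rw [Finset.sum_comm]
        simp only [Finset.mul_sum]
    _ ≤ ∑ y, (Real.exp (idxDist x y / l) * ‖A x y‖) * b := by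
        gcongr with y
        exact hB y
    _ ≤ a * b := by
        rw [← Finset.sum_mul]
        gcongr
        exact hA x

theorem RowBound.hasSum {A : ℕ → Matrix (Fin N) (Fin N) ℂ} {b : ℕ → ℝ}
    {A' : Matrix (Fin N) (Fin N) ℂ} {b' : ℝ} (h : ∀ k, RowBound l (A k) (b k))
    (hA : HasSum A A') (hb : HasSum b b') : RowBound l A' b' := fun x => by
  have hc : Continuous fun M : Matrix (Fin N) (Fin N) ℂ =>
      ∑ t, Real.exp (idxDist x t / l) * ‖M x t‖ := by
    refine continuous_finsetSum _ fun t _ => ?_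
    exact continuous_const.mul (continuous_id.matrix_elem x t).norm
  exact le_of_tendsto_of_tendsto ((hc.tendsto A').comp hA) hb
    (Filter.Eventually.of_forall fun s => RowBound.sum (fun i _ => h i) x)

theorem WeightedBound.mono (h : WeightedBound l A a) (hab : a ≤ b) : WeightedBound l A b :=
  ⟨h.1.mono hab, h.2.mono hab⟩

theorem weightedBound_one : WeightedBound l (1 : Matrix (Fin N) (Fin N) ℂ) 1 :=
  ⟨rowBound_one, by rw [Matrix.conjTranspose_one]; exact rowBound_one⟩

theorem WeightedBound.sum {ι : Type*} {s : Finset ι} {A : ι → Matrix (Fin N) (Fin N) ℂ}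
    {b : ι → ℝ} (h : ∀ i ∈ s, WeightedBound l (A i) (b i)) :
    WeightedBound l (∑ i ∈ s, A i) (∑ i ∈ s, b i) :=
  ⟨RowBound.sum fun i hi => (h i hi).1, by
    rw [Matrix.conjTranspose_sum]
    exact RowBound.sum fun i hi => (h i hi).2⟩

theorem WeightedBound.smul (h : WeightedBound l A b) (w : ℂ) :
    WeightedBound l (w • A) (‖w‖ * b) :=
  ⟨h.1.smul w, by
    rw [Matrix.conjTranspose_smul, ← norm_star w]
    exact h.2.smul _⟩

theorem WeightedBound.neg (h : WeightedBound l A b) : WeightedBound l (-A) b :=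
  ⟨h.1.neg, by rw [Matrix.conjTranspose_neg]; exact h.2.neg⟩

theorem WeightedBound.mul (hl : 0 < l) (ha : 0 ≤ a) (hb : 0 ≤ b) (hA : WeightedBound l A a)
    (hB : WeightedBound l B b) : WeightedBound l (A * B) (a * b) :=
  ⟨hA.1.mul hl hb hB.1, by
    rw [Matrix.conjTranspose_mul, mul_comm a b]
    exact hB.2.mul hl ha hA.2⟩

theorem WeightedBound.hasSum {A : ℕ → Matrix (Fin N) (Fin N) ℂ} {b : ℕ → ℝ}
    {A' : Matrix (Fin N) (Fin N) ℂ} {b' : ℝ} (h : ∀ k, WeightedBound l (A k) (b k))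
    (hA : HasSum A A') (hb : HasSum b b') : WeightedBound l A' b' :=
  ⟨RowBound.hasSum (fun k => (h k).1) hA hb,
    RowBound.hasSum (fun k => (h k).2) hA.matrix_conjTranspose hb⟩

/-- Both halves of the weighted bound are needed, since `A*` exchanges row and column sums. -/
theorem WeightedBound.imPart (h : WeightedBound l A b) : RowBound l (imPart A) b := by
  have := (h.1.add h.2.neg).smul (2 * Complex.I)⁻¹
  rw [← sub_eq_add_neg] at this
  refine this.mono (le_of_eq ?_)
  simp only [norm_inv, norm_mul, Complex.norm_ofNat, Complex.norm_I]
  ring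

variable {S : Matrix (Fin N) (Fin N) ℂ →ₗ[ℂ] Matrix (Fin N) (Fin N) ℂ}

theorem norm_coeff_le {c : ℝ} (hS : opLNorm l S ≤ c / N) (x y z t : Fin N) :
    ‖coeff S x y z t‖ ≤ c / N * Real.exp (-(rho x y z t / l)) := by
  have h : Real.exp (rho x y z t / l) * ‖coeff S x y z t‖ ≤ opLNorm l S :=
    le_ciSup (f := fun p : Fin N × Fin N × Fin N × Fin N =>
      Real.exp (rho p.1 p.2.1 p.2.2.1 p.2.2.2 / l) * ‖coeff S p.1 p.2.1 p.2.2.1 p.2.2.2‖)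
      (Set.finite_range _).bddAbove (x, y, z, t)
  rw [Real.exp_neg, ← div_eq_mul_inv, le_div_iff₀ (Real.exp_pos _), mul_comm]
  exact h.trans hS

/-- The kernel estimate behind `EntryBound.rowBound_apply`. -/
theorem exp_mul_exp_rho_mul_exp_le {l l' : ℝ} (hl : 0 < l) (hl' : l < l') (x y z t : Fin N) :
    Real.exp (idxDist x t / l') * Real.exp (-(rho x y z t / l)) * Real.exp (-(idxDist y z / l')) ≤
      Real.exp (-(l⁻¹ - l'⁻¹) * idxDist x t) * Real.exp (-(l⁻¹ - l'⁻¹) * idxDist y z) +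
      Real.exp (-(l⁻¹ - l'⁻¹) * idxDist x z) * Real.exp (-(l⁻¹ - l'⁻¹) * idxDist y t) := by
  simp only [← Real.exp_add, div_eq_mul_inv]
  have hp : 0 < l'⁻¹ := inv_pos.2 (hl.trans hl')
  have htri : idxDist x t ≤ idxDist x z + idxDist y z + idxDist y t := by
    rw [idxDist_comm y z]
    linarith [idxDist_triangle x z t, idxDist_triangle z y t]
  have hyz := idxDist_nonneg y z
  rcases min_choice (idxDist x t + idxDist y z) (idxDist x z + idxDist y t) with h | h
  · refine le_add_of_le_of_nonneg (Real.exp_le_exp.2 ?_) (Real.exp_pos _).le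
    rw [rho, h]
    nlinarith
  -- For this pairing `S` gives no decay in `|y - z|`; the decay of `R` pays for the `|y - z|` in
  -- the triangle inequality for `|x - t|`.
  · refine le_add_of_nonneg_of_le (Real.exp_pos _).le (Real.exp_le_exp.2 ?_)
    rw [rho, h]
    nlinarith

/-- For fixed `x` the sum runs over `t, y, z`, while each part of the kernel decays in two
differences. Two sums cost `G` each and the third costs `N`, which cancels the `1/N` in the size of
`S`. -/
theorem EntryBound.rowBound_apply {l l' G c b : ℝ} (hl : 0 < l) (hl' : l < l') (hc : 0 ≤ c)
    (hb : 0 ≤ b) (hG0 : 0 ≤ G)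
    (hG : ∀ x : Fin N, ∑ t, Real.exp (-(l⁻¹ - l'⁻¹) * idxDist x t) ≤ G)
    (hS : opLNorm l S ≤ c / N) {R : Matrix (Fin N) (Fin N) ℂ} (hR : EntryBound l' R b) :
    RowBound l' (S R) (2 * G ^ 2 * c * b) := fun x => by
  set E : Fin N → Fin N → ℝ := fun u v => Real.exp (-(l⁻¹ - l'⁻¹) * idxDist u v) with hE
  have hE0 : ∀ u v, 0 ≤ E u v := fun u v => (Real.exp_pos _).le
  have hN : (0 : ℝ) < N := by exact_mod_cast x.pos
  have hRyz : ∀ y z, ‖R y z‖ ≤ b * Real.exp (-(idxDist y z / l')) := fun y z => by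
    rw [Real.exp_neg, ← div_eq_mul_inv, le_div_iff₀ (Real.exp_pos _), mul_comm]
    exact hR y z
  have hterm : ∀ t, Real.exp (idxDist x t / l') * ‖S R x t‖ ≤
      c / N * b * ∑ y, ∑ z, (E x t * E y z + E x z * E y t) := by
    intro t
    rw [apply_eq_sum_coeff]
    calc _ ≤ Real.exp (idxDist x t / l') * ∑ y, ∑ z, ‖coeff S x y z t * R y z‖ := by
          gcongr
          exact (norm_sum_le _ _).trans (Finset.sum_le_sum fun y _ => norm_sum_le _ _)
      _ = ∑ y, ∑ z, Real.exp (idxDist x t / l') * (‖coeff S x y z t‖ * ‖R y z‖) := by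
          simp only [Finset.mul_sum, norm_mul]
      _ ≤ ∑ y, ∑ z, c / N * b * (E x t * E y z + E x z * E y t) := by
          refine Finset.sum_le_sum fun y _ => Finset.sum_le_sum fun z _ => ?_
          calc _ ≤ Real.exp (idxDist x t / l') * ((c / N * Real.exp (-(rho x y z t / l))) *
                (b * Real.exp (-(idxDist y z / l')))) := by
                gcongr
                · exact norm_coeff_le hS x y z t
                · exact hRyz y z
            _ = c / N * b * (Real.exp (idxDist x t / l') * Real.exp (-(rho x y z t / l)) *
                Real.exp (-(idxDist y z / l'))) := by ring
            _ ≤ _ := by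
                gcongr
                exact exp_mul_exp_rho_mul_exp_le hl hl' x y z t
      _ = _ := by simp only [Finset.mul_sum]
  have hEE : ∑ y, ∑ z, E y z ≤ N * G :=
    calc _ ≤ ∑ _y : Fin N, G := Finset.sum_le_sum fun y _ => hG y
      _ = _ := by simp
  have htot : ∑ t, ∑ y, ∑ z, (E x t * E y z + E x z * E y t) ≤ 2 * G ^ 2 * N := by
    have h1 : ∑ t, ∑ y, ∑ z, E x t * E y z = (∑ t, E x t) * ∑ y, ∑ z, E y z := by
      rw [Finset.sum_mul]
      simp only [Finset.mul_sum]
    have h2 : ∑ t, ∑ y, ∑ z, E x z * E y t = (∑ z, E x z) * ∑ y, ∑ t, E y t := by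
      rw [Finset.sum_comm, Finset.mul_sum]
      refine Finset.sum_congr rfl fun y _ => ?_
      rw [Finset.mul_sum]
      exact Finset.sum_congr rfl fun t _ => (Finset.sum_mul _ _ _).symm
    have h3 : (∑ t, E x t) * ∑ y, ∑ z, E y z ≤ G * (N * G) :=
      mul_le_mul (hG x) hEE (Finset.sum_nonneg fun _ _ => Finset.sum_nonneg fun _ _ => hE0 _ _) hG0
    simp only [Finset.sum_add_distrib]
    rw [h1, h2]
    linarith
  calc _ ≤ ∑ t, c / N * b * ∑ y, ∑ z, (E x t * E y z + E x z * E y t) :=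
        Finset.sum_le_sum fun t _ => hterm t
    _ ≤ c / N * b * (2 * G ^ 2 * N) := by
        rw [← Finset.mul_sum]
        gcongr
    _ = _ := by field_simp

end WeightedBounds

end MDE

namespace MDE

/-! ### Convergence of the tree series and the Dyson equation -/

section TreeSeries

open scoped Matrix

variable {N : ℕ} {S : Matrix (Fin N) (Fin N) ℂ →ₗ[ℂ] Matrix (Fin N) (Fin N) ℂ} {l κ : ℝ}

theorem catalan_le_four_pow (k : ℕ) : catalan k ≤ 4 ^ k := by
  rw [catalan_eq_centralBinom_div]
  calc _ ≤ k.centralBinom := Nat.div_le_self _ _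
    _ ≤ 2 ^ (2 * k) := Nat.choose_le_two_pow _ _
    _ = 4 ^ k := by rw [pow_mul]; norm_num

/-- `S` maps entrywise bounds to bounds on row sums. -/
def RowBounding (S : Matrix (Fin N) (Fin N) ℂ →ₗ[ℂ] Matrix (Fin N) (Fin N) ℂ) (l κ : ℝ) : Prop :=
  ∀ (R : Matrix (Fin N) (Fin N) ℂ) (b : ℝ), 0 ≤ b → EntryBound l R b → RowBound l (S R) (κ * b)

/-- Column sums reduce to row sums because positivity preservation makes `S` commute with the
adjoint. -/
theorem RowBounding.weightedBound (hS : PositivityPreserving S) (h : RowBounding S l κ)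
    {R : Matrix (Fin N) (Fin N) ℂ} {b : ℝ} (hb : 0 ≤ b) (hR : WeightedBound l R b) :
    WeightedBound l (S R) (κ * b) :=
  ⟨h R b hb hR.1.entryBound, by
    rw [conjTranspose_apply hS]
    exact h _ b hb hR.1.entryBound.conjTranspose⟩

theorem weightedBound_treeCoeff_catalan (hl : 0 < l) (hκ : 0 ≤ κ) (hS : PositivityPreserving S)
    (h : RowBounding S l κ) (k : ℕ) : WeightedBound l (treeCoeff S k) (catalan k * κ ^ k) := by
  induction k using Nat.strong_induction_on with
  | _ k ih =>
    cases k with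
    | zero => simpa [treeCoeff_zero] using weightedBound_one
    | succ k =>
      rw [treeCoeff_succ, catalan_succ', Nat.cast_sum, Finset.sum_mul]
      refine WeightedBound.sum fun p hp => ?_
      rw [Finset.HasAntidiagonal.mem_antidiagonal] at hp
      have h1 := h.weightedBound hS (by positivity) (ih p.1 (by omega))
      refine (h1.mul hl (by positivity) (by positivity) (ih p.2 (by omega))).mono (le_of_eq ?_)
      rw [← hp]
      push_cast
      ring

theorem weightedBound_treeCoeff (hl : 0 < l) (hκ : 0 ≤ κ) (hS : PositivityPreserving S)
    (h : RowBounding S l κ) (k : ℕ) : WeightedBound l (treeCoeff S k) ((4 * κ) ^ k) := by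
  refine (weightedBound_treeCoeff_catalan hl hκ hS h k).mono ?_
  rw [mul_pow]
  gcongr
  exact_mod_cast catalan_le_four_pow k

theorem weightedBound_seriesTerm (hl : 0 < l) (hκ : 0 ≤ κ) (hS : PositivityPreserving S)
    (h : RowBounding S l κ) (z : ℂ) (k : ℕ) :
    WeightedBound l (seriesTerm S z k) (‖z‖⁻¹ * (4 * κ / ‖z‖ ^ 2) ^ k) := by
  refine ((weightedBound_treeCoeff hl hκ hS h k).smul (z ^ (2 * k + 1))⁻¹).neg.mono (le_of_eq ?_)
  rw [norm_inv, norm_pow, pow_succ, pow_mul, mul_inv, div_pow]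
  ring

variable {z : ℂ}

theorem hasSum_geometric_bound (hκ : 0 ≤ κ) (hz : 4 * κ < ‖z‖ ^ 2) :
    HasSum (fun k : ℕ => ‖z‖⁻¹ * (4 * κ / ‖z‖ ^ 2) ^ k)
      (‖z‖⁻¹ * (1 - 4 * κ / ‖z‖ ^ 2)⁻¹) := by
  have h0 : 0 < ‖z‖ ^ 2 := by linarith
  exact (hasSum_geometric_of_lt_one (by positivity) ((div_lt_one h0).2 hz)).mul_left _

theorem summable_seriesTerm (hl : 0 < l) (hκ : 0 ≤ κ) (hS : PositivityPreserving S)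
    (h : RowBounding S l κ) (hz : 4 * κ < ‖z‖ ^ 2) : Summable fun k => seriesTerm S z k := by
  refine Pi.summable.2 fun x => Pi.summable.2 fun t => ?_
  exact Summable.of_norm_bounded (hasSum_geometric_bound hκ hz).summable fun k =>
    (weightedBound_seriesTerm hl hκ hS h z k).1.entryBound.norm_le hl x t

theorem weightedBound_treeSeries (hl : 0 < l) (hκ : 0 ≤ κ) (hS : PositivityPreserving S)
    (h : RowBounding S l κ) (hz : 4 * κ < ‖z‖ ^ 2) :
    WeightedBound l (treeSeries S z) (‖z‖⁻¹ * (1 - 4 * κ / ‖z‖ ^ 2)⁻¹) :=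
  WeightedBound.hasSum (weightedBound_seriesTerm hl hκ hS h z)
    (summable_seriesTerm hl hκ hS h hz).hasSum (hasSum_geometric_bound hκ hz)

theorem sum_antidiagonal_seriesTerm (hz : z ≠ 0) (k : ℕ) :
    ∑ p ∈ Finset.HasAntidiagonal.antidiagonal k, S (seriesTerm S z p.1) * seriesTerm S z p.2 =
      -(z • seriesTerm S z (k + 1)) := by
  have h : ∀ p ∈ Finset.HasAntidiagonal.antidiagonal k,
      S (seriesTerm S z p.1) * seriesTerm S z p.2 =
        (z ^ (2 * k + 2))⁻¹ • (S (treeCoeff S p.1) * treeCoeff S p.2) := by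
    intro p hp
    rw [Finset.HasAntidiagonal.mem_antidiagonal] at hp
    simp only [seriesTerm, map_neg, map_smul, neg_mul_neg, smul_mul_smul_comm]
    rw [← mul_inv, ← pow_add]
    congr 3
    omega
  rw [Finset.sum_congr rfl h, ← Finset.smul_sum, ← treeCoeff_succ, seriesTerm, smul_neg, neg_neg,
    smul_smul]
  congr 1
  rw [show 2 * (k + 1) + 1 = (2 * k + 2) + 1 by ring, pow_succ (n := 2 * k + 2)]
  field_simp

section

open scoped Matrix.Norms.Operator

theorem RowBound.linfty_opNorm_le (hl : 0 < l) {A : Matrix (Fin N) (Fin N) ℂ} {b : ℝ} (hb : 0 ≤ b)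
    (h : RowBound l A b) : ‖A‖ ≤ b := by
  lift b to NNReal using hb
  rw [Matrix.linfty_opNorm_def, NNReal.coe_le_coe]
  refine Finset.sup_le fun x _ => ?_
  rw [← NNReal.coe_le_coe]
  push_cast
  refine le_trans (Finset.sum_le_sum fun t _ => ?_) (h x)
  exact le_mul_of_one_le_left (norm_nonneg _)
    (Real.one_le_exp (div_nonneg (idxDist_nonneg x t) hl.le))

/-- The product of the two absolutely convergent series is a Cauchy product, which the recursion
turns into `-z` times the shifted series. Only the leading term `-1/z` survives, giving `-1`. -/
theorem apply_treeSeries_mul (hl : 0 < l) (hκ : 0 ≤ κ) (hS : PositivityPreserving S)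
    (h : RowBounding S l κ) (hz : 4 * κ < ‖z‖ ^ 2) :
    (z • (1 : Matrix (Fin N) (Fin N) ℂ) + S (treeSeries S z)) * treeSeries S z = -1 := by
  have hz0 : z ≠ 0 := by
    rintro rfl
    rw [norm_zero] at hz
    linarith
  have hsum := summable_seriesTerm hl hκ hS h hz
  have hgeo := (hasSum_geometric_bound (z := z) hκ hz).summable
  have hn1 : Summable fun k => ‖seriesTerm S z k‖ :=
    Summable.of_nonneg_of_le (fun _ => norm_nonneg _)
      (fun k => (weightedBound_seriesTerm hl hκ hS h z k).1.linfty_opNorm_le hl (by positivity))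
      hgeo
  have hn2 : Summable fun k => ‖S (seriesTerm S z k)‖ :=
    Summable.of_nonneg_of_le (fun _ => norm_nonneg _)
      (fun k => (h.weightedBound hS (by positivity)
        (weightedBound_seriesTerm hl hκ hS h z k)).1.linfty_opNorm_le hl (by positivity))
      (hgeo.mul_left κ)
  have hSM : S (treeSeries S z) = ∑' k, S (seriesTerm S z k) :=
    (LinearMap.toContinuousLinearMap S).map_tsum hsum
  have hprod : S (treeSeries S z) * treeSeries S z = -(z • ∑' k, seriesTerm S z (k + 1)) := by
    rw [hSM, treeSeries]
    refine (tsum_mul_tsum_eq_tsum_sum_antidiagonal_of_summable_norm hn2 hn1).trans ?_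
    simp only [sum_antidiagonal_seriesTerm hz0]
    rw [tsum_neg, tsum_const_smul'']
    rfl
  have hsplit : treeSeries S z = seriesTerm S z 0 + ∑' k, seriesTerm S z (k + 1) :=
    hsum.tsum_eq_zero_add
  have h0 : z • seriesTerm S z 0 = -1 := by
    simp [seriesTerm, treeCoeff_zero, smul_smul, hz0]
  rw [add_mul, hprod, smul_mul_assoc, one_mul, hsplit, smul_add, h0]
  abel

end

theorem solvesMDE_of_mul_eq_neg_one {M : Matrix (Fin N) (Fin N) ℂ}
    (h : (z • (1 : Matrix (Fin N) (Fin N) ℂ) + S M) * M = -1) : SolvesMDE S z M := by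
  have h' : (-(z • (1 : Matrix (Fin N) (Fin N) ℂ) + S M)) * M = 1 := by
    rw [neg_mul, h, neg_neg]
  refine ⟨IsUnit.of_mul_eq_one_right _ h', ?_⟩
  rw [Matrix.inv_eq_left_inv h', neg_neg]

/-! ### Positivity of the imaginary part for large `|z|` -/

section PositiveImaginaryPart

open scoped ComplexOrder

/-- With `B = z + S(M)`, `B M = -1` gives `M* (B - B*) M = M - M*`. -/
theorem imPart_eq_of_mul_eq_neg_one (hS : PositivityPreserving S) {M : Matrix (Fin N) (Fin N) ℂ}
    (h : (z • (1 : Matrix (Fin N) (Fin N) ℂ) + S M) * M = -1) :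
    imPart M = (z.im : ℂ) • (Mᴴ * M) + Mᴴ * S (imPart M) * M := by
  set B := z • (1 : Matrix (Fin N) (Fin N) ℂ) + S M with hB
  have h' : Mᴴ * Bᴴ = -1 := by
    rw [← Matrix.conjTranspose_mul, h, Matrix.conjTranspose_neg, Matrix.conjTranspose_one]
  have h1 : Mᴴ * imPart B * M = imPart M := by
    unfold imPart
    rw [Matrix.mul_smul, Matrix.smul_mul, Matrix.mul_sub, Matrix.sub_mul, Matrix.mul_assoc, h, h']
    congr 1
    rw [Matrix.mul_neg, Matrix.mul_one, Matrix.neg_mul, Matrix.one_mul]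
    abel
  have h2 : imPart B = (z.im : ℂ) • 1 + S (imPart M) := by
    rw [apply_imPart hS, hB]
    unfold imPart
    rw [Matrix.conjTranspose_add, Matrix.conjTranspose_smul, Matrix.conjTranspose_one,
      add_sub_add_comm, smul_add, ← sub_smul, smul_smul]
    congr 2
    change (2 * Complex.I)⁻¹ * (z - (starRingEnd ℂ) z) = _
    rw [Complex.sub_conj, Complex.ofReal_mul, Complex.ofReal_ofNat]
    field_simp
  rw [← h1, h2]
  -- `← h1` also rewrote the `imPart M` inside `S`; this restores it.
  conv_rhs => rw [← h2, h1]
  rw [Matrix.mul_add, Matrix.add_mul, Matrix.mul_smul, Matrix.smul_mul, Matrix.mul_one]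

/-- A fixed point `X = Y + T X` of a positivity preserving affine map whose linear part has
iterates tending to zero dominates `Y`. -/
theorem posSemidef_sub_of_eq_add {T : Matrix (Fin N) (Fin N) ℂ →ₗ[ℂ] Matrix (Fin N) (Fin N) ℂ}
    (hT : PositivityPreserving T) {X Y : Matrix (Fin N) (Fin N) ℂ} (hX : X.IsHermitian)
    (hY : Y.PosSemidef) (h : X = Y + T X)
    (hlim : Filter.Tendsto (fun n => T^[n] X) Filter.atTop (nhds 0)) : (X - Y).PosSemidef := by
  -- `X - T^{n+1} X` is the partial Neumann sum `Y + T Y + … + T^n Y`.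
  have hpos : ∀ n : ℕ, (X - T^[n + 1] X - Y).PosSemidef := by
    intro n
    induction n with
    | zero =>
      have : X - T^[0 + 1] X - Y = 0 := by
        rw [zero_add, Function.iterate_one]
        nth_rewrite 1 [h]
        abel
      rw [this]
      exact Matrix.PosSemidef.zero
    | succ n ih =>
      have : X - T^[n + 1 + 1] X - Y = T ((X - T^[n + 1] X - Y) + Y) := by
        rw [sub_add_cancel, map_sub, Function.iterate_succ_apply' T (n + 1)]
        nth_rewrite 1 [h]
        abel
      rw [this]
      exact hT _ (ih.add hY)
  rw [Matrix.posSemidef_iff_dotProduct_mulVec]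
  refine ⟨hX.sub hY.isHermitian, fun x => ?_⟩
  have hc : Continuous fun A : Matrix (Fin N) (Fin N) ℂ => star x ⬝ᵥ ((X - A - Y) *ᵥ x) := by
    fun_prop
  have ht := (hc.tendsto 0).comp (hlim.comp (Filter.tendsto_add_atTop_nat 1))
  rw [sub_zero] at ht
  exact ge_of_tendsto ht (Filter.Eventually.of_forall fun n => (hpos n).dotProduct_mulVec_nonneg x)

/-- The map `A ↦ M* S(A) M` scales weighted row sums by at most `m² κ < 1`, so its iterates on `Im
M` vanish in the limit and `Im M ≥ Im z · M*M`, which is positive definite because `M` is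
invertible. -/
theorem hasPosIm_of_mul_eq_neg_one (hl : 0 < l) (hκ : 0 ≤ κ) (hS : PositivityPreserving S)
    (h : RowBounding S l κ) (hz : 0 < z.im) {M : Matrix (Fin N) (Fin N) ℂ}
    (hM : (z • (1 : Matrix (Fin N) (Fin N) ℂ) + S M) * M = -1) {m : ℝ} (hm : 0 ≤ m)
    (hMm : WeightedBound l M m) (hlt : m ^ 2 * κ < 1) : HasPosIm M := by
  have hunit : IsUnit M := (solvesMDE_of_mul_eq_neg_one hM).1
  let T : Matrix (Fin N) (Fin N) ℂ →ₗ[ℂ] Matrix (Fin N) (Fin N) ℂ :=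
    (LinearMap.mulRight ℂ M) ∘ₗ (LinearMap.mulLeft ℂ Mᴴ) ∘ₗ S
  have hTapp : ∀ A, T A = Mᴴ * S A * M := fun A => rfl
  have hT : PositivityPreserving T := fun R hR => by
    rw [hTapp]
    exact (hS R hR).conjTranspose_mul_mul_same M
  have hzim : (0 : ℂ) < (z.im : ℂ) := Complex.zero_lt_real.2 hz
  have hMM : (Mᴴ * M).PosDef := by
    have := Matrix.PosDef.one.conjTranspose_mul_mul_same
      (Matrix.mulVec_injective_iff_isUnit.2 hunit)
    rwa [Matrix.mul_one] at this
  have hY : ((z.im : ℂ) • (Mᴴ * M)).PosDef := hMM.smul hzim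
  have hiter : ∀ n : ℕ, RowBound l (T^[n] (imPart M)) ((m ^ 2 * κ) ^ n * m) := by
    intro n
    induction n with
    | zero => simpa using hMm.imPart
    | succ n ih =>
      rw [Function.iterate_succ_apply', hTapp]
      have h1 := h _ _ (by positivity) ih.entryBound
      refine ((hMm.2.mul hl (by positivity) h1).mul hl hm hMm.1).mono (le_of_eq ?_)
      ring
  have hlim : Filter.Tendsto (fun n => T^[n] (imPart M)) Filter.atTop (nhds 0) := by
    refine tendsto_pi_nhds.2 fun x => tendsto_pi_nhds.2 fun t => ?_
    have hb : Filter.Tendsto (fun n : ℕ => (m ^ 2 * κ) ^ n * m) Filter.atTop (nhds 0) := by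
      simpa using (tendsto_pow_atTop_nhds_zero_of_lt_one (by positivity) hlt).mul_const m
    exact squeeze_zero_norm (fun n => (hiter n).entryBound.norm_le hl x t) hb
  have hpos := posSemidef_sub_of_eq_add hT (isHermitian_imPart M) hY.posSemidef
    (imPart_eq_of_mul_eq_neg_one hS hM) hlim
  have := hY.add_posSemidef hpos
  rwa [add_sub_cancel] at this

end PositiveImaginaryPart

end TreeSeries

end MDE

/-! ### Choice of constants and assembly -/

theorem mainTheorem1 (l : ℝ) (hl : 0 < l) (ε : ℝ) (hε : 0 < ε) :
    ∃ K : ℝ, 0 < K ∧ ∀ (c : ℝ), 0 ≤ c → ∀ (N : ℕ)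
      (S : Matrix (Fin N) (Fin N) ℂ →ₗ[ℂ] Matrix (Fin N) (Fin N) ℂ),
      MDE.PositivityPreserving S → MDE.opLNorm l S ≤ c / N →
      (∀ k : ℕ, MDE.matLNorm ((1 + ε) * l) (MDE.treeCoeff S k) ≤ (K * c) ^ k) ∧
      (∀ z : ℂ, K * c < ‖z‖ ^ 2 →
        Summable (fun k => MDE.matLNorm ((1 + ε) * l) (MDE.seriesTerm S z k)) ∧
        Summable (fun k => MDE.seriesTerm S z k) ∧
        MDE.matLNorm ((1 + ε) * l) (MDE.treeSeries S z)
          ≤ ‖z‖⁻¹ * (1 - K * c / ‖z‖ ^ 2)⁻¹ ∧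
        MDE.SolvesMDE S z (MDE.treeSeries S z)) ∧
      (∀ z : ℂ, 0 < z.im →
        ∃! M : Matrix (Fin N) (Fin N) ℂ, MDE.SolvesMDE S z M ∧ MDE.HasPosIm M) ∧
      (∀ z : ℂ, 0 < z.im → K * c < ‖z‖ ^ 2 → ∀ M : Matrix (Fin N) (Fin N) ℂ,
        (MDE.SolvesMDE S z M ∧ MDE.HasPosIm M) ↔ M = MDE.treeSeries S z) := by
  have hl' : l < (1 + ε) * l := by nlinarith
  have hl'0 : 0 < (1 + ε) * l := hl.trans hl'
  -- The gap between the decay rates `1/l` and `1/((1 + ε) l)` is what makes the sums over indices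
  -- bounded uniformly in `N`.
  obtain ⟨G, hG0, hG⟩ := MDE.exists_sum_exp_idxDist_le
    (d := l⁻¹ - ((1 + ε) * l)⁻¹) (sub_pos.2 (inv_strictAnti₀ hl hl'))
  -- Convergence alone needs `4κ`; the bound on the series degenerates at `|z|² = 4κ`, and `16κ`
  -- leaves room for the positivity argument.
  refine ⟨16 * (2 * G ^ 2), by positivity, fun c hc N S hS hSc => ?_⟩
  set κ := 2 * G ^ 2 * c with hκ
  have hκ0 : 0 ≤ κ := by positivity
  have hK : 16 * (2 * G ^ 2) * c = 16 * κ := by rw [hκ]; ring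
  rw [hK]
  have hrow : MDE.RowBounding S ((1 + ε) * l) κ := fun R b hb hR =>
    hR.rowBound_apply hl hl' hc hb hG0.le (hG N) hSc
  have hzlt : ∀ z : ℂ, 16 * κ < ‖z‖ ^ 2 → 4 * κ < ‖z‖ ^ 2 := fun z hz => by linarith
  have hunique : ∀ z : ℂ, 0 < z.im →
      ∃! M : Matrix (Fin N) (Fin N) ℂ, MDE.SolvesMDE S z M ∧ MDE.HasPosIm M :=
    fun z hz => MDE.existsUnique_solvesMDE hS hz
  refine ⟨fun k => ?_, fun z hz => ⟨?_, ?_, ?_, ?_⟩, hunique, fun z hz hzK M => ?_⟩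
  · refine ((MDE.weightedBound_treeCoeff hl'0 hκ0 hS hrow k).1.entryBound.matLNorm_le
      (by positivity)).trans ?_
    gcongr
    norm_num
  · refine Summable.of_nonneg_of_le
      (fun k => Real.iSup_nonneg fun p => by positivity)
      (fun k => (MDE.weightedBound_seriesTerm hl'0 hκ0 hS hrow z k).1.entryBound.matLNorm_le
        (by positivity))
      (MDE.hasSum_geometric_bound hκ0 (hzlt z hz)).summable
  · exact MDE.summable_seriesTerm hl'0 hκ0 hS hrow (hzlt z hz)
  · have h0 : 0 < ‖z‖ ^ 2 := by linarith
    have h1 : 16 * κ / ‖z‖ ^ 2 < 1 := (div_lt_one h0).2 hz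
    have h2 : 4 * κ / ‖z‖ ^ 2 ≤ 16 * κ / ‖z‖ ^ 2 := by gcongr; norm_num
    have h3 : 0 < 1 - 4 * κ / ‖z‖ ^ 2 := by linarith
    refine ((MDE.weightedBound_treeSeries hl'0 hκ0 hS hrow
      (hzlt z hz)).1.entryBound.matLNorm_le (by positivity)).trans ?_
    gcongr
  · exact MDE.solvesMDE_of_mul_eq_neg_one
      (MDE.apply_treeSeries_mul hl'0 hκ0 hS hrow (hzlt z hz))
  · have h0 : 0 < ‖z‖ ^ 2 := by linarith
    have h4 : 4 * κ / ‖z‖ ^ 2 ≤ 1 / 4 := by rw [div_le_iff₀ h0]; linarith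
    have hsol := MDE.apply_treeSeries_mul hl'0 hκ0 hS hrow (hzlt z hzK)
    -- Here `4κ/|z|² ≤ 1/4`, so the series is bounded by `m = 4/(3|z|)` and `m² κ = 16κ/(9|z|²) <
    -- 1`.
    have hbound := (MDE.weightedBound_treeSeries hl'0 hκ0 hS hrow (hzlt z hzK)).mono
      (b := ‖z‖⁻¹ * (3 / 4)⁻¹) (by gcongr; linarith)
    have hpos : MDE.HasPosIm (MDE.treeSeries S z) := by
      refine MDE.hasPosIm_of_mul_eq_neg_one hl'0 hκ0 hS hrow hz hsol (by positivity) hbound ?_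
      have : (‖z‖⁻¹ * (3 / 4)⁻¹) ^ 2 * κ = 16 / 9 * κ / ‖z‖ ^ 2 := by
        rw [mul_pow, inv_pow]
        ring
      rw [this, div_lt_one h0]
      linarith
    have hT : MDE.SolvesMDE S z (MDE.treeSeries S z) ∧ MDE.HasPosIm (MDE.treeSeries S z) :=
      ⟨MDE.solvesMDE_of_mul_eq_neg_one hsol, hpos⟩
    exact ⟨fun h => (hunique z hz).unique h hT, fun h => h ▸ hT⟩
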